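/- Let $D=(-1,1)$, let $\varrho$ be the uniform probability measure on $D$ ($d\varrho=\tfrac12dx$), and for $n\ge 1$ let $\mathbb P_{n-1}$ be the space of complex polynomials of degree less than $n$. For $f\in L^2_\varrho(D)$ let $f_n$ be the (unique) best $L^2_\varrho(D)$-approximation of $f$ from $\mathbb P_{n-1}$. For $\beta>-1$ let $\mu_\beta$ be the probability measure $$d\mu_\beta(x)=\frac{(1-x^2)^\beta\,dx}{\int_{-1}^1(1-t^2)^\beta\,dt}\quad\text{on } D,$$ and let $w=(d\mu_\beta/d\varrho)^{-1}$. Given i.i.d. points $x_1,\dots,x_m\sim\mu_\beta$ and data $y_i=f(x_i)+e_i$ with $e=(e_i)\in\mathbb C^m$, a weighted least-squares estimator $\hat f$ is a minimizer over $p\in\mathbb P_{n-1}$ of $\frac1m\sum_{i=1}^m w(x_i)|y_i-p(x_i)|^2$. For a measurable cost function $c:D\to(0,\infty)$ the expected cost is $C_{\mathsf{exp}}=\mathbb E\big(c(x_1)+\dots+c(x_m)\big)\in[0,\infty]$. There is an absolute constant $C>0$ such that the following holds. Let $\alpha\ge 0$. If $\alpha<1/2$, put $\beta=-1/2$ and $\theta=1$;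 if $\alpha\ge 1/2$, let $\delta>0$ be arbitrary and put $\beta=\alpha-1+\delta$ and $\theta=2(\alpha+\delta)$. There is a constant $K>0$, depending only on $\alpha$ (if $\alpha<1/2$), respectively only on $\alpha$ and $\delta$ (if $\alpha\ge1/2$), such that for every $n\ge1$ and every $0<\epsilon<1$ there is a number of samples $m\ge n$ with the following two properties, where the samples are drawn i.i.d. from $\mu_\beta$. (a) For every $A$ and every cost function $c$ with $c(x)\le A(1-x^2)^{-\alpha}$ on $(-1,1)$, $$C_{\mathsf{exp}}\le K\,A\,n^{\theta}\log(3n/\epsilon).$$ (b) For every $f\in L^2_\varrho(D)$, with probability at least $1-\epsilon$ the following holds: for every $e\in\mathbb C^m$ the weighted least-squares estimator $\hat f$ exists, is unique, and satisfies $$\|f-\hat f\|_{L^2_\varrho(D)}\le C\,\frac{n}{\sqrt\epsilon}\big(\|f-f_n\|_{L^2_\varrho(D)}+\|e\|_2\big),$$ $$\|f-\hat f\|_{L^\infty_\varrho(D)}\le C\Big(\|f-f_n\|_{L^\infty_\varrho(D)}+\frac{n}{\sqrt\epsilon}\big(\|f-f_n\|_{L^2_\varrho(D)}+\|e\|_2\big)\Big),$$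 where the right-hand side of the second bound is $+\infty$ if $f\notin L^\infty_\varrho(D)$. -/

import Mathlib

open MeasureTheory

namespace WLSCost

noncomputable section

/-- The domain `D = (-1, 1)`. -/
def dom : Set ℝ := Set.Ioo (-1) 1

/-- The uniform probability measure `dϱ(x) = dx / 2` on `(-1, 1)`. -/
def unif : Measure ℝ := (2⁻¹ : ENNReal) • (volume : Measure ℝ).restrict dom

/-- The Jacobi-type sampling measure
`dμ(x) = (1 - x ^ 2) ^ β dx / ∫_{-1}^{1} (1 - t ^ 2) ^ β dt` on `(-1, 1)`.
It does not depend on the polynomial degree. -/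
def jacobi (β : ℝ) : Measure ℝ :=
  ((volume : Measure ℝ).restrict dom).withDensity fun x =>
    ENNReal.ofReal ((1 - x ^ 2) ^ β / ∫ t in dom, (1 - t ^ 2) ^ β)

/-- The law of `m` i.i.d. sample points `x_1, …, x_m` drawn from `μ`. -/
def sampleLaw (μ : Measure ℝ) (m : ℕ) : Measure (Fin m → ℝ) :=
  Measure.pi fun _ => μ

/-- The weight function `w = 1 / v`, where `v = dμ / dϱ`. -/
def weight (μ : Measure ℝ) (x : ℝ) : ℝ := ((μ.rnDeriv unif x)⁻¹).toReal

/-- The approximation space `ℙ_{n-1}` of complex polynomials of degree less than `n`. -/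
abbrev polySpace (n : ℕ) : Submodule ℂ (Polynomial ℂ) := Polynomial.degreeLT ℂ n

/-- `‖f - p‖` in `L^q_ϱ(D)` (with `q = ⊤` the essential supremum), valued in `[0, ∞]`. -/
def err (q : ENNReal) (f : ℝ → ℂ) (p : Polynomial ℂ) : ENNReal :=
  eLpNorm (fun x : ℝ => f x - p.eval (x : ℂ)) q unif

/-- `g` is a best `L^2_ϱ(D)`-norm approximation of `f` from `ℙ_{n-1}`. -/
def IsBestApprox (n : ℕ) (f : ℝ → ℂ) (g : Polynomial ℂ) : Prop :=
  g ∈ polySpace n ∧ ∀ q ∈ polySpace n, err 2 f g ≤ err 2 f q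

/-- The weighted least-squares functional `(1/m) ∑ i, w(x_i) |y_i - p(x_i)|²`. -/
def lsObjective (μ : Measure ℝ) {m : ℕ} (x : Fin m → ℝ) (y : Fin m → ℂ)
    (p : Polynomial ℂ) : ℝ :=
  (1 / (m : ℝ)) * ∑ i, weight μ (x i) * ‖y i - p.eval (x i : ℂ)‖ ^ 2

/-- `p` is a weighted least-squares estimator: a minimizer over `ℙ_{n-1}` of the functional. -/
def IsEstimator (μ : Measure ℝ) (n : ℕ) {m : ℕ} (x : Fin m → ℝ) (y : Fin m → ℂ)
    (p : Polynomial ℂ) : Prop :=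
  p ∈ polySpace n ∧ ∀ q ∈ polySpace n, lsObjective μ x y p ≤ lsObjective μ x y q

/-- The expected cost `𝔼 (c(x_1) + ⋯ + c(x_m))` of `m` i.i.d. samples from `μ`, valued in
`[0, ∞]` (so it is `∞` when `c` is not integrable). -/
def expectedCost (μ : Measure ℝ) (m : ℕ) (c : ℝ → ℝ) : ENNReal :=
  ∫⁻ x, ∑ i, ENNReal.ofReal (c (x i)) ∂(sampleLaw μ m)

/-- A (measurable) cost function `c : (-1, 1) → (0, ∞)` with `c(x) ≤ A (1 - x ^ 2) ^ (-α)`. -/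
def IsCost (α A : ℝ) (c : ℝ → ℝ) : Prop :=
  AEMeasurable c unif ∧ ∀ x ∈ dom, 0 < c x ∧ c x ≤ A * (1 - x ^ 2) ^ (-α)

/-- For every `f ∈ L^2_ϱ(D)`, with `g` its unique best approximation from `ℙ_{n-1}`: with
probability at least `1 - ε` over `m` i.i.d. samples from `μ`, for every noise vector `e` the
weighted least-squares estimator for the data `y_i = f(x_i) + e_i` is unique, and it satisfies the
two error bounds with the constant `C`. The event contains a measurable event `E` of
probability at least `1 - ε`. -/
def QuasiBest (C : ℝ) (μ : Measure ℝ) (n m : ℕ) (ε : ℝ) : Prop :=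
  ∀ f : ℝ → ℂ, MemLp f 2 unif →
    ∃ g : Polynomial ℂ, IsBestApprox n f g ∧ (∀ q, IsBestApprox n f q → q = g) ∧
      ∃ E : Set (Fin m → ℝ), MeasurableSet E ∧
        ENNReal.ofReal (1 - ε) ≤ sampleLaw μ m E ∧
        ∀ x ∈ E, ∀ e : EuclideanSpace ℂ (Fin m),
          ∃ p : Polynomial ℂ,
            IsEstimator μ n x (fun i => f (x i) + e i) p ∧
            (∀ q, IsEstimator μ n x (fun i => f (x i) + e i) q → q = p) ∧
            err 2 f p ≤ ENNReal.ofReal (C * (n / Real.sqrt ε)) * (err 2 f g + ‖e‖ₑ) ∧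
            err ⊤ f p ≤ ENNReal.ofReal C *
              (err ⊤ f g + ENNReal.ofReal (n / Real.sqrt ε) * (err 2 f g + ‖e‖ₑ))

end

end WLSCost

open Polynomial MeasureTheory
open scoped ENNReal

namespace WLSCost

/-! The core is stability: outside an event of probability at most ε/3, the discrete weighted norm
at the samples dominates the L² norm on polynomials of degree below n, up to an absolute constant.
This is a deterministic fact (`marcinkiewicz_zygmund`) once every cell of a fixed mesh carries a
fair share of sample weight. The nodes have the form -cos(t + jh), so a cell near x has length of
order √(1-x²)/n. The oscillation of p² over such cells is paid for by the weighted Bernstein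
inequality, and the two leftover end gaps of length O(n⁻²) by the Nikolskii inequality. Both come
from `nikolskii_and_bernstein`, proved by induction along Legendre polynomials.

Randomness enters cell by cell. The weight in a cell is a sum of i.i.d. bounded variables with total
mean m times half the cell length, and a Chernoff bound makes a deficit exponentially unlikely
(`sampleLaw_cell_le`). The exponent is m times cell length over maximal weight, which is at least of
order m n^{-(2β+2)} when β ≥ -1/2 (`exists_cell_constant`). A union bound over 128n cells then asks
for m of order n^{2β+2} log(3n/ε).

Two applications of Markov's inequality control the weighted residual of f - f_n and the total
sample weight; the latter bounds each single weight, although the weight function may be unbounded.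
Stability turns this into a bound on the distance from the estimator to f_n, and Nikolskii's
inequality passes to the sup norm at the price of a factor n.

One sample costs at most A times a constant as soon as β - α > -1, so the cost has the same order as
m. The theorem takes the smallest exponent allowed: β = -1/2 when α < 1/2, and otherwise β just
above α - 1. -/

/-! ### Legendre polynomials; Nikolskii and Bernstein inequalities -/

/-- The integral of a real polynomial over `(-1, 1)`, as a linear functional. -/
noncomputable def polyInt : ℝ[X] →ₗ[ℝ] ℝ where
  toFun p := ∫ x in (-1 : ℝ)..1, p.eval x
  map_add' p q := by
    simp only [eval_add]
    exact intervalIntegral.integral_add (p.continuous.intervalIntegrable _ _)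
      (q.continuous.intervalIntegrable _ _)
  map_smul' c p := by simp [intervalIntegral.integral_const_mul]

theorem polyInt_apply (p : ℝ[X]) : polyInt p = ∫ x in (-1 : ℝ)..1, p.eval x := rfl

theorem polyInt_derivative (p : ℝ[X]) :
    polyInt (derivative p) = p.eval 1 - p.eval (-1) := by
  rw [polyInt_apply]
  exact intervalIntegral.integral_eq_sub_of_hasDerivAt (fun x _ => p.hasDerivAt x)
    ((derivative p).continuous.intervalIntegrable _ _)

theorem polyInt_nonneg {p : ℝ[X]} (h : ∀ x ∈ Set.Icc (-1 : ℝ) 1, 0 ≤ p.eval x) :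
    0 ≤ polyInt p :=
  intervalIntegral.integral_nonneg (by norm_num) h

theorem polyInt_sq_nonneg (p : ℝ[X]) : 0 ≤ polyInt (p * p) :=
  polyInt_nonneg fun x _ => by rw [eval_mul]; exact mul_self_nonneg _

theorem polyInt_sq_eq_zero {p : ℝ[X]} (h : polyInt (p * p) = 0) : p = 0 := by
  by_contra hp
  have hne : ∃ c ∈ Set.Icc (-1 : ℝ) 1, 0 < (p * p).eval c := by
    by_contra! hc
    refine hp (Polynomial.eq_zero_of_infinite_isRoot p
      ((Set.Icc_infinite (by norm_num : (-1 : ℝ) < 1)).mono fun x hx => ?_))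
    have := hc x hx
    rw [eval_mul] at this
    exact mul_self_eq_zero.1 (le_antisymm this (mul_self_nonneg _))
  have := intervalIntegral.integral_pos (by norm_num : (-1 : ℝ) < 1)
    (p * p).continuous.continuousOn
    (fun x _ => by rw [eval_mul]; exact mul_self_nonneg _) hne
  rw [polyInt_apply] at h
  exact this.ne' h

/-- The Legendre differential operator `p ↦ -((1 - x²) p')'`. -/
noncomputable def legendreOp (p : ℝ[X]) : ℝ[X] := -derivative ((1 - X ^ 2) * derivative p)

theorem polyInt_legendreOp_mul (p q : ℝ[X]) :
    polyInt (legendreOp p * q) = polyInt ((1 - X ^ 2) * derivative p * derivative q) := by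
  have h := polyInt_derivative ((1 - X ^ 2) * derivative p * q)
  have h0 : ((1 - X ^ 2) * derivative p * q).eval 1 -
      ((1 - X ^ 2) * derivative p * q).eval (-1) = 0 := by simp
  rw [h0, derivative_mul, map_add] at h
  rw [legendreOp, neg_mul, map_neg]
  linarith

theorem polyInt_legendreOp_comm (p q : ℝ[X]) :
    polyInt (legendreOp p * q) = polyInt (p * legendreOp q) := by
  rw [mul_comm p, polyInt_legendreOp_mul, polyInt_legendreOp_mul, mul_right_comm]

/-- The operator is triangular in the monomial basis: it does not raise degrees, and its diagonal
entries are the Legendre eigenvalues. -/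
theorem coeff_legendreOp (p : ℝ[X]) (k : ℕ) :
    (legendreOp p).coeff k = k * (k + 1) * p.coeff k - (k + 1) * (k + 2) * p.coeff (k + 2) := by
  rw [legendreOp, coeff_neg, coeff_derivative, sub_mul, one_mul, coeff_sub, coeff_derivative]
  rcases k with _ | k
  · rw [show (0 : ℕ) + 1 = 1 from rfl, coeff_X_pow_mul']
    norm_num
    ring
  · rw [show k + 1 + 1 = k + 2 from rfl, coeff_X_pow_mul, coeff_derivative]
    push_cast
    ring

theorem legendreOp_mem_degreeLT {n : ℕ} {p : ℝ[X]} (hp : p ∈ degreeLT ℝ n) :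
    legendreOp p ∈ degreeLT ℝ n := by
  rw [mem_degreeLT, degree_lt_iff_coeff_zero] at hp ⊢
  intro k hk
  rw [coeff_legendreOp, hp k hk, hp (k + 2) (by omega)]
  ring

/-- The L² form is definite on a finite-dimensional space, hence injective into the dual, hence onto
by dimension; the functional r ↦ ∫ p r is therefore represented. -/
theorem exists_orthogonal_remainder (n : ℕ) (p : ℝ[X]) :
    ∃ q ∈ degreeLT ℝ n, ∀ r ∈ degreeLT ℝ n, polyInt ((p - q) * r) = 0 := by
  let V := degreeLT ℝ n
  have : FiniteDimensional ℝ V := Module.Finite.equiv (degreeLTEquiv ℝ n).symm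
  let B : V →ₗ[ℝ] Module.Dual ℝ V := LinearMap.mk₂ ℝ (fun u v => polyInt ((u : ℝ[X]) * v))
    (fun u u' v => by simp [add_mul]) (fun c u v => by simp)
    (fun u v v' => by simp [mul_add]) (fun c u v => by simp)
  have hinj : Function.Injective B := by
    rw [injective_iff_map_eq_zero]
    intro u hu
    have : polyInt ((u : ℝ[X]) * u) = 0 := LinearMap.congr_fun hu u
    exact Subtype.ext (polyInt_sq_eq_zero this)
  have hsurj : Function.Surjective B :=
    (LinearMap.injective_iff_surjective_of_finrank_eq_finrank
      (Subspace.dual_finrank_eq (K := ℝ) (V := V)).symm).1 hinj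
  obtain ⟨q, hq⟩ := hsurj (polyInt ∘ₗ LinearMap.mulLeft ℝ p ∘ₗ V.subtype)
  refine ⟨q, q.2, fun r hr => ?_⟩
  have : polyInt ((q : ℝ[X]) * r) = polyInt (p * r) := LinearMap.congr_fun hq ⟨r, hr⟩
  rw [sub_mul, map_sub, this, sub_self]

/-- A monic polynomial of degree `n` orthogonal to all polynomials of smaller degree. -/
structure IsLegendre (n : ℕ) (L : ℝ[X]) : Prop where
  coeff_self : L.coeff n = 1
  coeff_gt : ∀ k, n < k → L.coeff k = 0
  orthogonal : ∀ r ∈ degreeLT ℝ n, polyInt (L * r) = 0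

theorem exists_isLegendre (n : ℕ) : ∃ L, IsLegendre n L := by
  obtain ⟨q, hq, h⟩ := exists_orthogonal_remainder n (X ^ n)
  rw [mem_degreeLT, degree_lt_iff_coeff_zero] at hq
  refine ⟨X ^ n - q, ?_, fun k hk => ?_, h⟩
  · simp [hq n le_rfl]
  · simp [hq k hk.le, coeff_X_pow, hk.ne']

/-- The defect between the two sides has degree below n because the top coefficients cancel. By
symmetry of the operator and orthogonality of L, the defect is orthogonal to itself. -/
theorem IsLegendre.legendreOp_eq {n : ℕ} {L : ℝ[X]} (hL : IsLegendre n L) :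
    legendreOp L = C ((n : ℝ) * (n + 1)) * L := by
  set r := legendreOp L - C ((n : ℝ) * (n + 1)) * L with hr
  have hmem : r ∈ degreeLT ℝ n := by
    rw [mem_degreeLT, degree_lt_iff_coeff_zero]
    intro k hk
    rw [hr, coeff_sub, coeff_legendreOp, coeff_C_mul, hL.coeff_gt (k + 2) (by omega)]
    rcases hk.eq_or_lt with rfl | hk
    · ring
    · rw [hL.coeff_gt k hk]; ring
  have h0 : polyInt (r * r) = 0 := by
    have : r * r = legendreOp L * r - ((n : ℝ) * (n + 1)) • (L * r) := by
      rw [smul_eq_C_mul]; nth_rewrite 1 [hr]; ring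
    rw [this, map_sub, polyInt_legendreOp_comm, hL.orthogonal _ (legendreOp_mem_degreeLT hmem),
      map_smul, hL.orthogonal _ hmem]
    simp
  exact sub_eq_zero.1 (polyInt_sq_eq_zero h0)

/-- Integrate (xL²)' = (2n+1)L² + 2L(xL' - nL); the last bracket has degree below n, so its product
with L integrates to zero. -/
theorem IsLegendre.sq_endpoints {n : ℕ} {L : ℝ[X]} (hL : IsLegendre n L) :
    L.eval 1 ^ 2 + L.eval (-1) ^ 2 = (2 * n + 1) * polyInt (L * L) := by
  have h := polyInt_derivative (X * (L * L))
  have hmem : X * derivative L - C (n : ℝ) * L ∈ degreeLT ℝ n := by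
    rw [mem_degreeLT, degree_lt_iff_coeff_zero]
    intro k hk
    rcases k with _ | k
    · obtain rfl : n = 0 := by omega
      simp
    rw [coeff_sub, coeff_X_mul, coeff_derivative, coeff_C_mul]
    rcases hk.eq_or_lt with h | h
    · rw [h]; push_cast; ring
    · rw [hL.coeff_gt _ h]; ring
  have h2 := hL.orthogonal _ hmem
  have e : derivative (X * (L * L)) =
      (2 * (n : ℝ) + 1) • (L * L) + (2 : ℝ) • (L * (X * derivative L - C (n : ℝ) * L)) := by
    simp only [derivative_mul, derivative_X, smul_eq_C_mul, map_add, map_mul, map_one,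
      map_ofNat]
    ring
  rw [e, map_add, map_smul, map_smul, h2] at h
  simp only [eval_mul, eval_X, smul_eq_mul] at h
  linarith

/-- Sonin's argument: F = λL² + (1-x²)L'² with λ = n(n+1) satisfies F' = 2xL'² by Legendre's
equation. So F grows away from 0 towards either endpoint; it dominates λL² and equals it at ±1. -/
theorem IsLegendre.sq_eval_le {n : ℕ} {L : ℝ[X]} (hL : IsLegendre n L) {x : ℝ}
    (hx : x ∈ Set.Icc (-1 : ℝ) 1) :
    L.eval x ^ 2 ≤ (2 * n + 1) * polyInt (L * L) := by
  rw [← hL.sq_endpoints]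
  -- In degree 0 the eigenvalue λ vanishes and cannot be cancelled at the end.
  rcases Nat.eq_zero_or_pos n with rfl | hn
  · have : L = C 1 := by
      ext k
      rcases Nat.eq_zero_or_pos k with rfl | hk
      · simp [hL.coeff_self]
      · rw [hL.coeff_gt k hk, coeff_C, if_neg hk.ne']
    simp [this]
  have hn' : (0 : ℝ) < n := by exact_mod_cast hn
  set lam : ℝ := n * (n + 1) with hlam
  have hlam0 : 0 < lam := by positivity
  set F : ℝ[X] := C lam * L ^ 2 + (1 - X ^ 2) * derivative L ^ 2 with hF
  have hF' : derivative F = 2 * X * derivative L ^ 2 := by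
    have := hL.legendreOp_eq
    rw [legendreOp, derivative_mul, ← hlam] at this
    have e1 : derivative (1 - X ^ 2 : ℝ[X]) = -(2 * X) := by
      simp only [derivative_sub, derivative_one, derivative_X_sq, zero_sub, map_ofNat]
    rw [e1] at this
    have e : C lam * L = 2 * X * derivative L - (1 - X ^ 2) * derivative (derivative L) := by
      rw [← this]; ring
    have : derivative F = 2 * (C lam * L) * derivative L
        + (-(2 * X)) * derivative L ^ 2
        + (1 - X ^ 2) * (2 * derivative L * derivative (derivative L)) := by
      rw [hF, derivative_add, derivative_mul, derivative_mul, e1, derivative_sq, derivative_sq]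
      simp only [derivative_C, map_ofNat]
      ring
    rw [this, e]; ring
  have hle : ∀ y, y ∈ Set.Icc (-1 : ℝ) 1 → lam * L.eval y ^ 2 ≤ F.eval y := by
    intro y hy
    have : 0 ≤ (1 - y ^ 2) * (derivative L).eval y ^ 2 :=
      mul_nonneg (by nlinarith [hy.1, hy.2]) (sq_nonneg _)
    simp [hF]
    linarith
  have hderiv : ∀ y, deriv (fun z => F.eval z) y = 2 * y * (derivative L).eval y ^ 2 := by
    intro y
    rw [F.deriv, hF']; simp
  have hfin : F.eval x ≤ lam * (L.eval 1 ^ 2 + L.eval (-1) ^ 2) := by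
    rcases le_total 0 x with h0 | h0
    · have mono : MonotoneOn (fun z => F.eval z) (Set.Icc 0 1) :=
        monotoneOn_of_deriv_nonneg (convex_Icc 0 1) F.continuous.continuousOn
          F.differentiable.differentiableOn fun y hy => by
            rw [interior_Icc] at hy
            rw [hderiv]
            have := hy.1.le
            positivity
      have := mono ⟨h0, hx.2⟩ (Set.right_mem_Icc.2 zero_le_one) hx.2
      refine this.trans ?_
      simp [hF]
      nlinarith [sq_nonneg (L.eval (-1))]
    · have anti : AntitoneOn (fun z => F.eval z) (Set.Icc (-1) 0) :=
        antitoneOn_of_deriv_nonpos (convex_Icc (-1) 0) F.continuous.continuousOn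
          F.differentiable.differentiableOn fun y hy => by
            rw [interior_Icc] at hy
            rw [hderiv]
            exact mul_nonpos_of_nonpos_of_nonneg (by linarith [hy.2]) (sq_nonneg _)
      have := anti (Set.left_mem_Icc.2 (by norm_num)) ⟨hx.1, h0⟩ hx.1
      refine this.trans ?_
      simp [hF]
      nlinarith [sq_nonneg (L.eval 1)]
  exact le_of_mul_le_mul_left ((hle x hx).trans hfin) hlam0

/-- Induction by splitting off the Legendre component of degree n, orthogonal to the rest. For point
values the constants add up to (2n+1) + n² = (n+1)². For the derivative form the cross term also
vanishes, and the new eigenvalue n(n+1) is at most (n+1)². -/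
theorem nikolskii_and_bernstein (n : ℕ) : ∀ p ∈ degreeLT ℝ n,
    (∀ x ∈ Set.Icc (-1 : ℝ) 1, p.eval x ^ 2 ≤ n ^ 2 * polyInt (p * p)) ∧
      polyInt ((1 - X ^ 2) * derivative p * derivative p) ≤ n ^ 2 * polyInt (p * p) := by
  induction n with
  | zero =>
    intro p hp
    rw [mem_degreeLT, degree_lt_iff_coeff_zero] at hp
    have : p = 0 := by ext k; simp [hp k (Nat.zero_le _)]
    subst this
    simp
  | succ n ih =>
    intro p hp
    obtain ⟨L, hL⟩ := exists_isLegendre n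
    rw [mem_degreeLT, degree_lt_iff_coeff_zero] at hp
    set c := p.coeff n with hc
    set q := p - C c * L with hq
    have hqm : q ∈ degreeLT ℝ n := by
      rw [mem_degreeLT, degree_lt_iff_coeff_zero]
      intro k hk
      rw [hq, coeff_sub, coeff_C_mul]
      rcases hk.eq_or_lt with rfl | h
      · rw [hL.coeff_self]; simp [hc]
      · rw [hL.coeff_gt _ h, hp k h]; simp
    have hpe : p = C c * L + q := by rw [hq]; ring
    obtain ⟨h1, h2⟩ := ih q hqm
    have hn : polyInt (p * p) = c ^ 2 * polyInt (L * L) + polyInt (q * q) := by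
      have : p * p = c ^ 2 • (L * L) + (2 * c) • (L * q) + q * q := by
        rw [hpe]; simp only [smul_eq_C_mul, map_mul, map_pow, map_ofNat]; ring
      rw [this, map_add, map_add, map_smul, map_smul, hL.orthogonal q hqm]
      simp
    have hLL := polyInt_sq_nonneg L
    have hqq := polyInt_sq_nonneg q
    constructor
    · intro x hx
      have a1 := hL.sq_eval_le hx
      have a2 := h1 x hx
      have ev : p.eval x = c * L.eval x + q.eval x := by
        conv_lhs => rw [hpe]
        simp
      rw [ev, hn]
      push_cast
      set u := c * L.eval x
      have hu : u ^ 2 ≤ (2 * n + 1) * (c ^ 2 * polyInt (L * L)) := by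
        have := mul_le_mul_of_nonneg_left a1 (sq_nonneg c)
        calc u ^ 2 = c ^ 2 * L.eval x ^ 2 := by ring
          _ ≤ _ := this
          _ = _ := by ring
      set v := q.eval x
      set s := c ^ 2 * polyInt (L * L) with hs
      have hs0 : 0 ≤ s := by positivity
      set t := polyInt (q * q)
      rcases Nat.eq_zero_or_pos n with h0 | h0
      · subst h0
        have : v = 0 := by
          have : v ^ 2 ≤ 0 := by simpa using a2
          exact pow_eq_zero_iff two_ne_zero |>.1 (le_antisymm this (sq_nonneg _))
        rw [this]
        simp at hu ⊢
        linarith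
      · have hn0 : (0 : ℝ) < n := by exact_mod_cast h0
        -- Cauchy–Schwarz with weights 2n+1 and n², cleared of denominators; its defect is the
        -- square given to `nlinarith`. The weight n² must be nonzero, hence the separate case n =
        -- 0.
        have key : (u + v) ^ 2 * ((2 * n + 1) * n ^ 2) ≤
            ((n + 1 : ℝ) ^ 2 * (s + t)) * ((2 * n + 1) * n ^ 2) := by
          nlinarith [sq_nonneg (u * n ^ 2 - v * (2 * n + 1)),
            mul_le_mul_of_nonneg_left hu (by positivity : (0:ℝ) ≤ (n + 1) ^ 2 * n ^ 2),
            mul_le_mul_of_nonneg_left a2 (by positivity : (0:ℝ) ≤ (n + 1) ^ 2 * (2 * n + 1))]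
        exact le_of_mul_le_mul_right key (by positivity)
    · have e : polyInt ((1 - X ^ 2) * derivative p * derivative p) =
          c ^ 2 * (n * (n + 1)) * polyInt (L * L)
            + polyInt ((1 - X ^ 2) * derivative q * derivative q) := by
        have hLx : ∀ r, polyInt ((1 - X ^ 2) * derivative L * derivative r) =
            n * (n + 1) * polyInt (L * r) := fun r => by
          rw [← polyInt_legendreOp_mul, hL.legendreOp_eq, mul_assoc, ← smul_eq_C_mul, map_smul,
            smul_eq_mul]
        have : (1 - X ^ 2) * derivative p * derivative p =
            c ^ 2 • ((1 - X ^ 2) * derivative L * derivative L)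
            + (2 * c) • ((1 - X ^ 2) * derivative L * derivative q)
            + (1 - X ^ 2) * derivative q * derivative q := by
          rw [hpe]; simp only [smul_eq_C_mul, map_mul, map_pow, map_ofNat, derivative_add,
            derivative_mul, derivative_C]; ring
        rw [this, map_add, map_add, map_smul, map_smul, hLx, hLx, hL.orthogonal q hqm]
        simp only [smul_eq_mul]
        ring
      rw [e, hn]
      push_cast
      have hn0 : (0 : ℝ) ≤ n := n.cast_nonneg
      nlinarith [mul_nonneg (sq_nonneg c) hLL, mul_nonneg hn0 (mul_nonneg (sq_nonneg c) hLL),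
        mul_nonneg hn0 hqq]

/-! ### A deterministic Marcinkiewicz–Zygmund inequality -/

theorem integral_sq_le_of_mem (p : ℝ[X]) {a b y : ℝ} (hab : a ≤ b) (hy : y ∈ Set.Icc a b) :
    ∫ x in a..b, (p * p).eval x ≤
      (b - a) * p.eval y ^ 2 + (b - a) * ∫ x in a..b, |(derivative (p * p)).eval x| := by
  have hcont : Continuous fun x => |(derivative (p * p)).eval x| :=
    (derivative (p * p)).continuous.abs
  have hpt : ∀ x ∈ Set.Icc a b,
      (p * p).eval x ≤ p.eval y ^ 2 + ∫ x in a..b, |(derivative (p * p)).eval x| := by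
    intro x hx
    have h1 : ∫ z in y..x, (derivative (p * p)).eval z = (p * p).eval x - (p * p).eval y :=
      intervalIntegral.integral_eq_sub_of_hasDerivAt (fun z _ => (p * p).hasDerivAt z)
        ((derivative (p * p)).continuous.intervalIntegrable _ _)
    have h2 : |∫ z in y..x, (derivative (p * p)).eval z| ≤
        |(∫ z in y..x, |(derivative (p * p)).eval z|)| := by
      simpa using intervalIntegral.norm_integral_le_abs_integral_norm
        (f := fun z => (derivative (p * p)).eval z) (a := y) (b := x) (μ := MeasureTheory.volume)
    have h3 : |(∫ z in y..x, |(derivative (p * p)).eval z|)| ≤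
        |(∫ z in a..b, |(derivative (p * p)).eval z|)| := by
      refine intervalIntegral.abs_integral_mono_interval ?_
        (Filter.Eventually.of_forall fun z => abs_nonneg _) (hcont.intervalIntegrable _ _)
      rw [Set.uIoc_of_le hab]
      exact Set.Ioc_subset_Ioc (le_min hy.1 hx.1) (max_le hy.2 hx.2)
    have h4 : 0 ≤ ∫ z in a..b, |(derivative (p * p)).eval z| :=
      intervalIntegral.integral_nonneg hab fun z _ => abs_nonneg _
    rw [abs_of_nonneg h4] at h3
    have := (le_abs_self _).trans (h2.trans h3)
    rw [h1] at this
    have e : (p * p).eval y = p.eval y ^ 2 := by rw [eval_mul, sq]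
    linarith
  have := intervalIntegral.integral_mono_on hab ((p * p).continuous.intervalIntegrable _ _)
    (intervalIntegrable_const (μ := MeasureTheory.volume)) hpt
  rw [intervalIntegral.integral_const, smul_eq_mul] at this
  linarith

/-- Compare ∫p² over the cell with the value of p² at each sample in it, then average over these
samples with weights ω. The error is the variation of p², split into a small multiple of ∫p² and a
Bernstein term. -/
theorem cell_sum_le {ι : Type*} [Fintype ι] {n : ℕ} (hn : 1 ≤ n) (p : ℝ[X]) {a b : ℝ}
    (hab : a < b) (hmesh : ∀ x ∈ Set.Icc a b, 64 * (n : ℝ) ^ 2 * (b - a) ^ 2 ≤ 1 - x ^ 2)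
    (x : ι → ℝ) (ω : ι → ℝ) (hω : ∀ i, 0 ≤ ω i) {κ : ℝ}
    (hκ : b - a ≤ κ * ∑ i, (Set.Ico a b).indicator (fun _ => ω i) (x i)) :
    ∫ t in a..b, (p * p).eval t ≤ 1 / 8 * (∫ t in a..b, (p * p).eval t)
      + 1 / (8 * (n : ℝ) ^ 2) * (∫ t in a..b, ((1 - X ^ 2) * derivative p * derivative p).eval t)
      + κ * ∑ i, (Set.Ico a b).indicator (fun _ => ω i * p.eval (x i) ^ 2) (x i) := by
  have hn0 : (0 : ℝ) < n := by exact_mod_cast hn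
  set P := ∫ t in a..b, (p * p).eval t with hP
  set Q := ∫ t in a..b, ((1 - X ^ 2) * derivative p * derivative p).eval t with hQ
  set S := ∑ i, (Set.Ico a b).indicator (fun _ => ω i) (x i) with hS
  set T := ∑ i, (Set.Ico a b).indicator (fun _ => ω i * p.eval (x i) ^ 2) (x i) with hT
  have hPc : Continuous fun t => 1 / 8 * (p * p).eval t :=
    continuous_const.mul (p * p).continuous
  have hQc : Continuous fun t =>
      1 / (8 * (n : ℝ) ^ 2) * ((1 - X ^ 2) * derivative p * derivative p).eval t :=
    continuous_const.mul (Polynomial.continuous _)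
  have hVc : Continuous fun t => (b - a) * |(derivative (p * p)).eval t| :=
    continuous_const.mul (Polynomial.continuous _).abs
  -- Young's inequality: 2(b-a)|pp'| ≤ p²/8 + 8(b-a)²p'²; the mesh condition turns the last term
  -- into (1-t²)p'²/(8n²).
  have hvar : (b - a) * ∫ t in a..b, |(derivative (p * p)).eval t| ≤
      1 / 8 * P + 1 / (8 * (n : ℝ) ^ 2) * Q := by
    rw [hP, hQ, ← intervalIntegral.integral_const_mul, ← intervalIntegral.integral_const_mul,
      ← intervalIntegral.integral_const_mul, ← intervalIntegral.integral_add
        (hPc.intervalIntegrable _ _) (hQc.intervalIntegrable _ _)]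
    refine intervalIntegral.integral_mono_on hab.le (hVc.intervalIntegrable _ _)
      ((hPc.add hQc).intervalIntegrable _ _) fun t ht => ?_
    have h := hmesh t ht
    rw [derivative_mul]
    simp only [eval_add, eval_mul, eval_sub, eval_one, eval_pow, eval_X]
    set u := p.eval t
    set v := (derivative p).eval t
    have e : v * u + u * v = 2 * (u * v) := by ring
    rw [e, abs_mul, abs_two, abs_mul]
    have h8 : 8 * ((b - a) * |v|) ^ 2 ≤ 1 / (8 * (n : ℝ) ^ 2) * ((1 - t ^ 2) * v * v) := by
      have h' : 64 * (n : ℝ) ^ 2 * (b - a) ^ 2 * v ^ 2 ≤ (1 - t ^ 2) * v ^ 2 :=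
        mul_le_mul_of_nonneg_right h (sq_nonneg v)
      rw [mul_pow, sq_abs, one_div, inv_mul_eq_div, le_div_iff₀ (by positivity)]
      calc _ = 64 * (n : ℝ) ^ 2 * (b - a) ^ 2 * v ^ 2 := by ring
        _ ≤ _ := h'
        _ = _ := by ring
    have hu : |u| ^ 2 = u * u := by rw [sq_abs, sq]
    nlinarith [sq_nonneg (|u| - 8 * ((b - a) * |v|))]
  have hi : S * (P - (1 / 8 * P + 1 / (8 * (n : ℝ) ^ 2) * Q)) ≤ (b - a) * T := by
    rw [hS, hT, Finset.sum_mul, Finset.mul_sum]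
    refine Finset.sum_le_sum fun i _ => ?_
    by_cases hx : x i ∈ Set.Ico a b
    · rw [Set.indicator_of_mem hx, Set.indicator_of_mem hx]
      have := integral_sq_le_of_mem p hab.le (Set.Ico_subset_Icc_self hx)
      rw [← hP] at this
      calc ω i * (P - (1 / 8 * P + 1 / (8 * (n : ℝ) ^ 2) * Q))
          ≤ ω i * ((b - a) * p.eval (x i) ^ 2) :=
            mul_le_mul_of_nonneg_left (by linarith) (hω i)
        _ = _ := by ring
    · rw [Set.indicator_of_notMem hx, Set.indicator_of_notMem hx]; simp
  have hS0 : 0 ≤ S := Finset.sum_nonneg fun i _ => Set.indicator_nonneg (fun _ _ => hω i) _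
  have hT0 : 0 ≤ T := Finset.sum_nonneg fun i _ =>
    Set.indicator_nonneg (fun _ _ => mul_nonneg (hω i) (sq_nonneg _)) _
  have hSpos : 0 < S := by
    rcases hS0.eq_or_lt with h | h
    · rw [← h] at hκ; linarith
    · exact h
  have : S * (P - (1 / 8 * P + 1 / (8 * (n : ℝ) ^ 2) * Q)) ≤ S * (κ * T) :=
    hi.trans ((mul_le_mul_of_nonneg_right hκ hT0).trans (by rw [mul_left_comm, mul_assoc]))
  have := le_of_mul_le_mul_left this hSpos
  linarith

/-- Four errors of at most 1/8 of ∫p² each (variation, Bernstein, and the two end gaps) add up to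
one half, which is absorbed on the left; hence the factor 2. -/
theorem marcinkiewicz_zygmund {ι : Type*} [Fintype ι] {n N : ℕ} (hn : 1 ≤ n) {a : ℕ → ℝ}
    (hmono : ∀ j < N, a j < a (j + 1)) (ha0 : -1 ≤ a 0) (haN : a N ≤ 1)
    (ha0' : 8 * (n : ℝ) ^ 2 * (a 0 + 1) ≤ 1) (haN' : 8 * (n : ℝ) ^ 2 * (1 - a N) ≤ 1)
    (hmesh : ∀ j < N, ∀ x ∈ Set.Icc (a j) (a (j + 1)),
      64 * (n : ℝ) ^ 2 * (a (j + 1) - a j) ^ 2 ≤ 1 - x ^ 2)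
    (x : ι → ℝ) (ω : ι → ℝ) (hω : ∀ i, 0 ≤ ω i) {κ : ℝ} (hκ0 : 0 ≤ κ)
    (hκ : ∀ j < N, a (j + 1) - a j ≤
      κ * ∑ i, (Set.Ico (a j) (a (j + 1))).indicator (fun _ => ω i) (x i))
    {p : ℝ[X]} (hp : p ∈ degreeLT ℝ n) :
    polyInt (p * p) ≤ 2 * κ * ∑ i, ω i * p.eval (x i) ^ 2 := by
  have hn0 : (0 : ℝ) < n := by exact_mod_cast hn
  obtain ⟨hsup, hbern⟩ := nikolskii_and_bernstein n p hp
  set A := polyInt (p * p) with hA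
  have hA0 : 0 ≤ A := polyInt_sq_nonneg p
  set Q : ℝ[X] := (1 - X ^ 2) * derivative p * derivative p with hQ
  have hle : ∀ {k : ℕ}, k ≤ N → a 0 ≤ a k := by
    intro k
    induction k with
    | zero => intro _; exact le_rfl
    | succ k ih => intro hk; exact (ih (by omega)).trans (hmono k (by omega)).le
  have hii : ∀ (q : ℝ[X]) (u v : ℝ),
      IntervalIntegrable (fun t => q.eval t) MeasureTheory.volume u v :=
    fun q u v => q.continuous.intervalIntegrable _ _
  have hsum : ∀ q : ℝ[X], ∑ j ∈ Finset.range N, ∫ t in a j..a (j + 1), q.eval t =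
      ∫ t in a 0..a N, q.eval t := fun q =>
    intervalIntegral.sum_integral_adjacent_intervals fun k _ => hii q _ _
  have hmid : ∀ q : ℝ[X], (∀ t ∈ Set.Icc (-1 : ℝ) 1, 0 ≤ q.eval t) →
      ∫ t in a 0..a N, q.eval t ≤ polyInt q := by
    intro q hq
    refine intervalIntegral.integral_mono_interval ha0 (hle le_rfl) haN ?_ (hii q _ _)
    filter_upwards [MeasureTheory.ae_restrict_mem measurableSet_Ioc] with t ht
    exact hq t (Set.Ioc_subset_Icc_self ht)
  have hPmid := hmid (p * p) fun t _ => by rw [eval_mul]; exact mul_self_nonneg _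
  have hQmid := hmid Q fun t ht => by
    rw [hQ, mul_assoc]
    simp only [eval_mul, eval_sub, eval_one, eval_pow, eval_X]
    exact mul_nonneg (by nlinarith [ht.1, ht.2]) (mul_self_nonneg _)
  have hcell := Finset.sum_le_sum fun j (hj : j ∈ Finset.range N) =>
    cell_sum_le hn p (hmono j (Finset.mem_range.1 hj)) (hmesh j (Finset.mem_range.1 hj)) x ω hω
      (hκ j (Finset.mem_range.1 hj))
  rw [Finset.sum_add_distrib, Finset.sum_add_distrib, ← Finset.mul_sum, ← Finset.mul_sum,
    ← Finset.mul_sum, hsum, hsum, Finset.sum_comm] at hcell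
  -- The half-open cells are disjoint, so a sample counts at most once. The induction bounds the
  -- partial sum by the indicator of everything left of `a k`.
  have hdisj : ∀ i, ∑ j ∈ Finset.range N, (Set.Ico (a j) (a (j + 1))).indicator
      (fun _ => ω i * p.eval (x i) ^ 2) (x i) ≤ ω i * p.eval (x i) ^ 2 := by
    intro i
    have hnn : 0 ≤ ω i * p.eval (x i) ^ 2 := mul_nonneg (hω i) (sq_nonneg _)
    have : ∀ k, k ≤ N → ∑ j ∈ Finset.range k, (Set.Ico (a j) (a (j + 1))).indicator
        (fun _ => ω i * p.eval (x i) ^ 2) (x i) ≤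
        (Set.Iio (a k)).indicator (fun _ => ω i * p.eval (x i) ^ 2) (x i) := by
      intro k
      induction k with
      | zero => intro _; simpa using Set.indicator_nonneg (fun _ _ => hnn) _
      | succ k ih =>
        intro hk
        rw [Finset.sum_range_succ]
        have h1 := ih (by omega)
        have hk' := hmono k (by omega)
        by_cases h : x i < a k
        · rw [Set.indicator_of_notMem (s := Set.Ico _ _) (fun h' => absurd h'.1 (not_le.2 h)),
            add_zero]
          rw [Set.indicator_of_mem (Set.mem_Iio.2 h)] at h1
          rwa [Set.indicator_of_mem (Set.mem_Iio.2 (h.trans hk'))]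
        · rw [Set.indicator_of_notMem (s := Set.Iio (a k)) (by simpa using h)] at h1
          have h2 : (Set.Ico (a k) (a (k + 1))).indicator
              (fun _ => ω i * p.eval (x i) ^ 2) (x i) ≤
              (Set.Iio (a (k + 1))).indicator (fun _ => ω i * p.eval (x i) ^ 2) (x i) :=
            Set.indicator_le_indicator_of_subset (fun z hz => hz.2) (fun _ => hnn) _
          linarith
    exact (this N le_rfl).trans (Set.indicator_le_self' (fun _ _ => hnn) _)
  have hS := mul_le_mul_of_nonneg_left
    (Finset.sum_le_sum fun i (_ : i ∈ Finset.univ) => hdisj i) hκ0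
  have hend : ∀ u v : ℝ, -1 ≤ u → u ≤ v → v ≤ 1 → 8 * (n : ℝ) ^ 2 * (v - u) ≤ 1 →
      ∫ t in u..v, (p * p).eval t ≤ 1 / 8 * A := by
    intro u v h1 h2 h3 h4
    have := intervalIntegral.integral_mono_on h2 (hii (p * p) _ _)
      (intervalIntegrable_const (c := (n : ℝ) ^ 2 * A)) fun t ht => by
        rw [eval_mul, ← sq]
        exact hsup t ⟨h1.trans ht.1, ht.2.trans h3⟩
    rw [intervalIntegral.integral_const, smul_eq_mul] at this
    nlinarith [mul_le_mul_of_nonneg_right h4 hA0]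
  have hl := hend (-1) (a 0) le_rfl ha0 ((hle le_rfl).trans haN) (by linarith)
  have hr := hend (a N) 1 (ha0.trans (hle le_rfl)) haN le_rfl haN'
  have hsplit : A = (∫ t in (-1)..a 0, (p * p).eval t) + (∫ t in a 0..a N, (p * p).eval t)
      + ∫ t in a N..1, (p * p).eval t := by
    rw [intervalIntegral.integral_add_adjacent_intervals (hii _ _ _) (hii _ _ _),
      intervalIntegral.integral_add_adjacent_intervals (hii _ _ _) (hii _ _ _)]
    rfl
  have hQ' : 1 / (8 * (n : ℝ) ^ 2) * ∫ t in a 0..a N, Q.eval t ≤ 1 / 8 * A := by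
    rw [one_div, inv_mul_eq_div, div_le_iff₀ (by positivity)]
    linarith
  linarith

/-! ### The cosine mesh -/

theorem sin_le_sin_of_mem_Icc {t s : ℝ} (ht : 0 ≤ t) (hs : s ∈ Set.Icc t (Real.pi - t)) :
    Real.sin t ≤ Real.sin s := by
  rcases le_total s (Real.pi / 2) with h | h
  · exact Real.sin_le_sin_of_le_of_le_pi_div_two (by linarith [Real.pi_pos]) h hs.1
  · rw [← Real.sin_pi_sub s]
    exact Real.sin_le_sin_of_le_of_le_pi_div_two (by linarith [Real.pi_pos]) (by linarith)
      (by linarith [hs.2])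

/-- The sine is 1-Lipschitz and at least sin t ≥ h on the whole range, so over a step h it changes
by a factor of at most 2. The mean value theorem then gives the cell length, and 1 - cos² = sin² the
rest. -/
theorem cos_cell_bounds {t φ h : ℝ} (ht : 0 ≤ t) (hh : 0 < h) (hht : h ≤ Real.sin t)
    (hφ : t ≤ φ) (hφ' : φ + h ≤ Real.pi - t) :
    h * Real.sin φ / 2 ≤ -Real.cos (φ + h) - -Real.cos φ ∧
    -Real.cos (φ + h) - -Real.cos φ ≤ 2 * h * Real.sin φ ∧
    ∀ x ∈ Set.Icc (-Real.cos φ) (-Real.cos (φ + h)),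
      Real.sin φ ^ 2 / 4 ≤ 1 - x ^ 2 ∧ 1 - x ^ 2 ≤ 4 * Real.sin φ ^ 2 := by
  have hs : ∀ ψ ∈ Set.Icc φ (φ + h), Real.sin φ / 2 ≤ Real.sin ψ ∧
      Real.sin ψ ≤ 2 * Real.sin φ := by
    intro ψ hψ
    have h1 := sin_le_sin_of_mem_Icc ht (s := ψ) ⟨hφ.trans hψ.1, hψ.2.trans hφ'⟩
    have h2 := sin_le_sin_of_mem_Icc ht (s := φ) ⟨hφ, by linarith⟩
    have h3 : |Real.sin ψ - Real.sin φ| ≤ h := by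
      refine (Real.abs_sin_sub_sin_le ψ φ).trans ?_
      rw [abs_of_nonneg (by linarith [hψ.1])]
      linarith [hψ.2]
    rw [abs_le] at h3
    constructor <;> linarith [h3.1, h3.2]
  have hpos : 0 ≤ Real.sin φ :=
    hh.le.trans (hht.trans (sin_le_sin_of_mem_Icc ht ⟨hφ, by linarith⟩))
  have hcont : Continuous fun z => -Real.cos z := Real.continuous_cos.neg
  have hder : ∀ z, HasDerivAt (fun z => -Real.cos z) (Real.sin z) z := fun z =>
    (Real.hasDerivAt_cos z).fun_neg.congr_deriv (neg_neg _)
  obtain ⟨ξ, hξ, hξ'⟩ := exists_hasDerivAt_eq_slope (fun z => -Real.cos z) Real.sin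
    (by linarith : φ < φ + h) hcont.continuousOn
    (fun z _ => hder z)
  rw [add_sub_cancel_left, eq_div_iff hh.ne'] at hξ'
  obtain ⟨b1, b2⟩ := hs ξ (Set.Ioo_subset_Icc_self hξ)
  refine ⟨by rw [← hξ']; nlinarith, by rw [← hξ']; nlinarith, fun x hx => ?_⟩
  obtain ⟨ψ, hψ, rfl⟩ := intermediate_value_Icc (by linarith : φ ≤ φ + h)
    hcont.continuousOn hx
  obtain ⟨c1, c2⟩ := hs ψ hψ
  have : 1 - (-Real.cos ψ) ^ 2 = Real.sin ψ ^ 2 := by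
    have := Real.sin_sq_add_cos_sq ψ
    rw [neg_sq]; linarith
  simp only [this]
  constructor <;> nlinarith

/-- Angles run from t = 1/(4n) to π - t in 128n equal steps h. Then 1 - cos t ≤ t²/2 makes the end
gaps short, Jordan's inequality gives sin t ≥ 1/(8n), and π ≤ 4 gives 32nh ≤ 1, which is what the
mesh condition needs. The witness s is the sine of the left angle of the cell. -/
theorem exists_cosine_mesh {n : ℕ} (hn : 1 ≤ n) : ∃ a : ℕ → ℝ,
    -1 ≤ a 0 ∧ a (128 * n) ≤ 1 ∧ 8 * (n : ℝ) ^ 2 * (a 0 + 1) ≤ 1 ∧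
    8 * (n : ℝ) ^ 2 * (1 - a (128 * n)) ≤ 1 ∧
    ∀ j < 128 * n, a j < a (j + 1) ∧ ∃ s : ℝ, 1 / (8 * n) ≤ s ∧
      s / (256 * n) ≤ a (j + 1) - a j ∧
      ∀ x ∈ Set.Icc (a j) (a (j + 1)), 64 * (n : ℝ) ^ 2 * (a (j + 1) - a j) ^ 2 ≤ 1 - x ^ 2 ∧
        s ^ 2 / 4 ≤ 1 - x ^ 2 ∧ 1 - x ^ 2 ≤ 4 * s ^ 2 := by
  have hn0 : (1 : ℝ) ≤ n := by exact_mod_cast hn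
  have hpi3 := Real.pi_gt_three
  have hpi4 := Real.pi_le_four
  set t : ℝ := 1 / (4 * n) with ht
  have ht0 : 0 < t := by positivity
  have htn : t * n = 1 / 4 := by rw [ht]; field_simp
  have ht1 : t ≤ 1 / 4 := by nlinarith
  set h : ℝ := (Real.pi - 2 * t) / (128 * n) with hh
  have hhn : h * (128 * n) = Real.pi - 2 * t := by rw [hh]; field_simp
  have hh0 : 0 < h := div_pos (by linarith) (by positivity)
  have hsin : 1 / (8 * (n : ℝ)) ≤ Real.sin t := by
    have h1 := Real.mul_le_sin ht0.le (by linarith : t ≤ Real.pi / 2)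
    have h2 : 1 / 2 ≤ 2 / Real.pi := by
      rw [div_le_div_iff₀ (by norm_num) (by linarith)]; linarith
    have h3 : 1 / (8 * (n : ℝ)) = 1 / 2 * t := by rw [ht]; field_simp; norm_num
    rw [h3]
    exact (mul_le_mul_of_nonneg_right h2 ht0.le).trans h1
  have hh32 : 32 * n * h ≤ 1 := by nlinarith
  have hht : h ≤ Real.sin t := by
    refine le_trans ?_ hsin
    rw [le_div_iff₀ (by positivity)]
    nlinarith
  have hcos := Real.one_sub_sq_div_two_le_cos (x := t)
  have htend : 8 * (n : ℝ) ^ 2 * (1 - Real.cos t) ≤ 1 := by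
    have : 8 * (n : ℝ) ^ 2 * (1 - Real.cos t) ≤ 8 * (n : ℝ) ^ 2 * (t ^ 2 / 2) :=
      mul_le_mul_of_nonneg_left (by linarith) (by positivity)
    nlinarith
  have hlast : t + ((128 * n : ℕ) : ℝ) * h = Real.pi - t := by push_cast; linarith
  refine ⟨fun j => -Real.cos (t + j * h), ?_, ?_, ?_, ?_, ?_⟩
  · linarith [Real.cos_le_one (t + ((0 : ℕ) : ℝ) * h)]
  · linarith [Real.neg_one_le_cos (t + ((128 * n : ℕ) : ℝ) * h)]
  · simp only [Nat.cast_zero, zero_mul, add_zero]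
    linarith
  · simp only [hlast, Real.cos_pi_sub]
    linarith
  intro j hj
  have hj' : ((j : ℝ) + 1) ≤ 128 * n := by exact_mod_cast hj
  have e : t + ((j + 1 : ℕ) : ℝ) * h = (t + j * h) + h := by push_cast; ring
  simp only [e]
  have hφ : t ≤ t + j * h := by nlinarith [(Nat.cast_nonneg j : (0 : ℝ) ≤ j)]
  have hφ' : t + j * h + h ≤ Real.pi - t := by nlinarith
  obtain ⟨b1, b2, b3⟩ := cos_cell_bounds ht0.le hh0 hht hφ hφ'
  have hs := hsin.trans (sin_le_sin_of_mem_Icc ht0.le (s := t + j * h) ⟨hφ, by linarith⟩)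
  set s := Real.sin (t + j * h)
  have hs0 : 0 < s := lt_of_lt_of_le (by positivity) hs
  have hd : 0 < h * s / 2 := by positivity
  refine ⟨by linarith, s, hs, ?_, fun x hx => ⟨?_, b3 x hx⟩⟩
  · refine le_trans ?_ b1
    rw [div_le_iff₀ (by positivity)]
    nlinarith
  · have h1 := (b3 x hx).1
    have h2 : (-Real.cos (t + j * h + h) - -Real.cos (t + j * h)) ^ 2 ≤ (2 * h * s) ^ 2 :=
      pow_le_pow_left₀ (by linarith) b2 2
    have h3 : (32 * n * h) ^ 2 ≤ 1 := pow_le_one₀ (by positivity) hh32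
    calc 64 * (n : ℝ) ^ 2 * _ ≤ 64 * (n : ℝ) ^ 2 * (2 * h * s) ^ 2 :=
          mul_le_mul_of_nonneg_left h2 (by positivity)
      _ = (32 * n * h) ^ 2 * (s ^ 2 / 4) := by ring
      _ ≤ 1 * (s ^ 2 / 4) := mul_le_mul_of_nonneg_right h3 (by positivity)
      _ ≤ _ := by linarith

/-! ### Jacobi measures, weights and expected cost -/

/-- The normalising constant of the Jacobi-type measure. -/
noncomputable def jacobiMass (γ : ℝ) : ℝ := ∫ t in dom, (1 - t ^ 2) ^ γ

theorem one_sub_sq_pos {x : ℝ} (hx : x ∈ dom) : 0 < 1 - x ^ 2 := by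
  nlinarith [hx.1, hx.2]

theorem measurableSet_dom : MeasurableSet dom := measurableSet_Ioo

theorem measurable_one_sub_sq_rpow (γ : ℝ) : Measurable fun x : ℝ => (1 - x ^ 2) ^ γ := by
  fun_prop

/-- The majorant is (1+x)^γ + (1-x)^γ + 1: the constant serves γ ≥ 0, and for γ ≤ 0 the factor of
the farther endpoint is at least 1 and can be dropped. -/
theorem integrableOn_one_sub_sq_rpow {γ : ℝ} (hγ : -1 < γ) :
    IntegrableOn (fun x : ℝ => (1 - x ^ 2) ^ γ) dom := by
  have hbase : IntervalIntegrable (fun x : ℝ => x ^ γ) volume 0 2 :=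
    intervalIntegral.intervalIntegrable_rpow' hγ
  have h1 : IntegrableOn (fun x : ℝ => (1 + x) ^ γ) dom := by
    have := (hbase.comp_add_left 1).1
    norm_num at this
    exact this.mono_set Set.Ioo_subset_Ioc_self
  have h2 : IntegrableOn (fun x : ℝ => (1 - x) ^ γ) dom := by
    have := (hbase.comp_sub_left 1).2
    norm_num at this
    exact this.mono_set Set.Ioo_subset_Ioc_self
  have h3 : IntegrableOn (fun _ : ℝ => (1 : ℝ)) dom :=
    integrableOn_const (by simp [dom])
  refine Integrable.mono' ((h1.add h2).add h3)
    (measurable_one_sub_sq_rpow γ).aestronglyMeasurable ?_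
  filter_upwards [ae_restrict_mem measurableSet_dom] with x hx
  have hp := one_sub_sq_pos hx
  have ha : 0 < 1 + x := by linarith [hx.1]
  have hb : 0 < 1 - x := by linarith [hx.2]
  simp only [Pi.add_apply]
  rw [Real.norm_of_nonneg (Real.rpow_nonneg hp.le _)]
  have pa := Real.rpow_nonneg ha.le γ
  have pb := Real.rpow_nonneg hb.le γ
  rcases le_total 0 γ with h | h
  · have : (1 - x ^ 2) ^ γ ≤ 1 := Real.rpow_le_one hp.le (by nlinarith [sq_nonneg x]) h
    linarith
  · rcases le_total 0 x with hx0 | hx0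
    · have : (1 - x ^ 2) ^ γ ≤ (1 - x) ^ γ :=
        Real.rpow_le_rpow_of_nonpos hb (by nlinarith) h
      linarith
    · have : (1 - x ^ 2) ^ γ ≤ (1 + x) ^ γ :=
        Real.rpow_le_rpow_of_nonpos ha (by nlinarith) h
      linarith

theorem jacobiMass_pos {γ : ℝ} (hγ : -1 < γ) : 0 < jacobiMass γ := by
  have hpos : ∀ x ∈ dom, 0 < (1 - x ^ 2) ^ γ := fun x hx =>
    Real.rpow_pos_of_pos (one_sub_sq_pos hx) _
  rw [jacobiMass, setIntegral_pos_iff_support_of_nonneg_ae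
    ((ae_restrict_mem measurableSet_dom).mono fun x hx => (hpos x hx).le)
    (integrableOn_one_sub_sq_rpow hγ)]
  have hsub : dom ⊆ Function.support fun x : ℝ => (1 - x ^ 2) ^ γ := fun x hx => (hpos x hx).ne'
  rw [Set.inter_eq_right.2 hsub]
  simp [dom]

instance : IsProbabilityMeasure unif := by
  constructor
  rw [unif, Measure.smul_apply, Measure.restrict_apply MeasurableSet.univ, Set.univ_inter, dom,
    Real.volume_Ioo, smul_eq_mul]
  norm_num
  exact ENNReal.inv_mul_cancel (by norm_num) (by norm_num)

/-- The density of the Jacobi-type measure with respect to Lebesgue measure. -/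
noncomputable def jacobiDensity (β : ℝ) (x : ℝ) : ℝ≥0∞ :=
  ENNReal.ofReal ((1 - x ^ 2) ^ β / jacobiMass β)

theorem jacobi_eq (β : ℝ) :
    jacobi β = ((volume : Measure ℝ).restrict dom).withDensity (jacobiDensity β) := rfl

theorem measurable_jacobiDensity (β : ℝ) : Measurable (jacobiDensity β) :=
  ((measurable_one_sub_sq_rpow β).div_const _).ennreal_ofReal

theorem isProbabilityMeasure_jacobi {β : ℝ} (hβ : -1 < β) : IsProbabilityMeasure (jacobi β) := by
  constructor
  have hm := jacobiMass_pos hβ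
  rw [jacobi_eq, withDensity_apply _ MeasurableSet.univ, Measure.restrict_univ]
  unfold jacobiDensity
  rw [← ofReal_integral_eq_lintegral_ofReal ((integrableOn_one_sub_sq_rpow hβ).div_const _),
    integral_div, ← jacobiMass, div_self hm.ne', ENNReal.ofReal_one]
  filter_upwards [ae_restrict_mem measurableSet_dom] with x hx
  exact div_nonneg (Real.rpow_nonneg (one_sub_sq_pos hx).le _) hm.le

theorem unif_eq : unif = (2⁻¹ : ℝ≥0∞) • (volume : Measure ℝ).restrict dom := rfl

theorem ae_unif_iff {P : ℝ → Prop} :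
    (∀ᵐ x ∂unif, P x) ↔ ∀ᵐ x ∂(volume : Measure ℝ).restrict dom, P x := by
  rw [unif_eq, Measure.ae_ennreal_smul_measure_iff (by norm_num)]

theorem lintegral_unif (F : ℝ → ℝ≥0∞) : ∫⁻ x, F x ∂unif = 2⁻¹ * ∫⁻ x in dom, F x := by
  rw [unif_eq, lintegral_smul_measure, smul_eq_mul]

theorem jacobi_absolutelyContinuous (β : ℝ) : jacobi β ≪ unif := by
  refine Measure.AbsolutelyContinuous.trans (withDensity_absolutelyContinuous _ _) ?_
  intro s hs
  rw [unif_eq, Measure.smul_apply, smul_eq_mul, mul_eq_zero] at hs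
  exact hs.resolve_left (by norm_num)

/-- The weight `dϱ / dμ_β` in closed form. -/
noncomputable def jacobiWeight (β : ℝ) (x : ℝ) : ℝ := jacobiMass β / (2 * (1 - x ^ 2) ^ β)

theorem measurable_jacobiWeight (β : ℝ) : Measurable (jacobiWeight β) :=
  measurable_const.div ((measurable_one_sub_sq_rpow β).const_mul 2)

theorem jacobiWeight_pos {β : ℝ} (hβ : -1 < β) {x : ℝ} (hx : x ∈ dom) : 0 < jacobiWeight β x :=
  div_pos (jacobiMass_pos hβ) (mul_pos two_pos (Real.rpow_pos_of_pos (one_sub_sq_pos hx) _))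

theorem jacobi_eq_withDensity_unif (β : ℝ) :
    jacobi β = unif.withDensity fun x => 2 * jacobiDensity β x := by
  have : (fun x => 2 * jacobiDensity β x) = (2 : ℝ≥0∞) • jacobiDensity β := rfl
  rw [this, withDensity_smul _ (measurable_jacobiDensity β), unif_eq, withDensity_smul_measure,
    smul_smul, ENNReal.mul_inv_cancel (by norm_num) (by norm_num), one_smul, jacobi_eq]

/-- The Radon–Nikodym derivative is determined only up to null sets, so the closed form holds only
almost everywhere; the sampling argument later discards a null event for this. -/
theorem weight_ae_eq {β : ℝ} (hβ : -1 < β) :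
    ∀ᵐ x ∂unif, x ∈ dom ∧ weight (jacobi β) x = jacobiWeight β x := by
  have h1 : (jacobi β).rnDeriv unif =ᵐ[unif] fun x => 2 * jacobiDensity β x := by
    rw [jacobi_eq_withDensity_unif]
    exact Measure.rnDeriv_withDensity _ ((measurable_jacobiDensity β).const_mul 2)
  have h2 : ∀ᵐ x ∂unif, x ∈ dom := ae_unif_iff.2 (ae_restrict_mem measurableSet_dom)
  filter_upwards [h1, h2] with x hx hxd
  refine ⟨hxd, ?_⟩
  have hp := Real.rpow_pos_of_pos (one_sub_sq_pos hxd) β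
  have hm := jacobiMass_pos hβ
  rw [weight, hx, jacobiDensity, jacobiWeight, ENNReal.toReal_inv, ENNReal.toReal_mul,
    ENNReal.toReal_ofReal (by positivity), ENNReal.toReal_ofNat]
  field_simp

theorem lintegral_jacobiWeight_mul {β : ℝ} (hβ : -1 < β) (F : ℝ → ℝ≥0∞) :
    ∫⁻ x, ENNReal.ofReal (jacobiWeight β x) * F x ∂jacobi β = ∫⁻ x, F x ∂unif := by
  rw [jacobi_eq_withDensity_unif, lintegral_withDensity_eq_lintegral_mul_non_measurable _
    ((measurable_jacobiDensity β).const_mul 2)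
    (Filter.Eventually.of_forall fun x => ENNReal.mul_lt_top (by simp) ENNReal.ofReal_lt_top)]
  refine lintegral_congr_ae ?_
  filter_upwards [weight_ae_eq hβ] with x hx
  have hp := Real.rpow_pos_of_pos (one_sub_sq_pos hx.1) β
  have hm := jacobiMass_pos hβ
  have e : 2 * jacobiDensity β x * ENNReal.ofReal (jacobiWeight β x) = 1 := by
    rw [jacobiDensity, jacobiWeight, show (2 : ℝ≥0∞) = ENNReal.ofReal 2 by simp,
      ← ENNReal.ofReal_mul (by norm_num), ← ENNReal.ofReal_mul (by positivity),
      ← ENNReal.ofReal_one]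
    congr 1
    field_simp
  simp only [Pi.mul_apply]
  rw [← mul_assoc, e, one_mul]

/-- The cost bound times the density is again of Jacobi type with exponent β - α, integrable because
it exceeds -1; linearity gives the factor m. -/
theorem expectedCost_jacobi_le {α β A : ℝ} (hβ : -1 < β) (hαβ : -1 < β - α) (m : ℕ) {c : ℝ → ℝ}
    (hc : IsCost α A c) :
    expectedCost (jacobi β) m c ≤
      ENNReal.ofReal (m * (A * (jacobiMass (β - α) / jacobiMass β))) := by
  have := isProbabilityMeasure_jacobi hβ
  have hm := jacobiMass_pos hβ
  have hA : 0 < A := by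
    have := hc.2 0 (by simp [dom])
    norm_num at this
    linarith
  have hmeas : AEMeasurable (fun x => ENNReal.ofReal (c x)) (jacobi β) :=
    (hc.1.mono_ac (jacobi_absolutelyContinuous β)).ennreal_ofReal
  have hone : ∫⁻ x, ENNReal.ofReal (c x) ∂jacobi β ≤
      ENNReal.ofReal (A * (jacobiMass (β - α) / jacobiMass β)) := by
    rw [jacobi_eq, lintegral_withDensity_eq_lintegral_mul_non_measurable _
      (measurable_jacobiDensity β)
      (Filter.Eventually.of_forall fun x => ENNReal.ofReal_lt_top)]
    have hint := ((integrableOn_one_sub_sq_rpow hαβ).div_const (jacobiMass β)).const_mul A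
    have e : A * (jacobiMass (β - α) / jacobiMass β) =
        ∫ x in dom, A * ((1 - x ^ 2) ^ (β - α) / jacobiMass β) := by
      rw [integral_const_mul, integral_div]; rfl
    rw [e, ofReal_integral_eq_lintegral_ofReal hint]
    · refine lintegral_mono_ae ?_
      filter_upwards [ae_restrict_mem measurableSet_dom] with x hx
      have hp := one_sub_sq_pos hx
      rw [Pi.mul_apply, jacobiDensity, ← ENNReal.ofReal_mul
        (div_nonneg (Real.rpow_nonneg hp.le _) hm.le)]
      refine ENNReal.ofReal_le_ofReal ?_
      have := mul_le_mul_of_nonneg_left (hc.2 x hx).2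
        (div_nonneg (Real.rpow_nonneg hp.le β) hm.le)
      refine this.trans (le_of_eq ?_)
      rw [sub_eq_add_neg β α, Real.rpow_add hp]
      ring
    · filter_upwards [ae_restrict_mem measurableSet_dom] with x hx
      have := Real.rpow_nonneg (one_sub_sq_pos hx).le (β - α)
      positivity
  have hmp : ∀ i : Fin m, MeasurePreserving (Function.eval i) (sampleLaw (jacobi β) m) (jacobi β) :=
    fun i => measurePreserving_eval (fun _ : Fin m => jacobi β) i
  have hmeas' : ∀ i : Fin m,
      AEMeasurable (fun x : Fin m → ℝ => ENNReal.ofReal (c (x i))) (sampleLaw (jacobi β) m) :=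
    fun i => hmeas.comp_quasiMeasurePreserving (hmp i).quasiMeasurePreserving
  rw [expectedCost, lintegral_finsetSum' _ fun i _ => hmeas' i]
  have : ∀ i : Fin m, ∫⁻ x, ENNReal.ofReal (c (x i)) ∂sampleLaw (jacobi β) m ≤
      ENNReal.ofReal (A * (jacobiMass (β - α) / jacobiMass β)) := fun i => by
    rw [← (hmp i).map_eq, lintegral_map' ((hmp i).map_eq.symm ▸ hmeas) (hmp i).aemeasurable] at hone
    exact hone
  refine (Finset.sum_le_sum fun i _ => this i).trans ?_
  rw [Finset.sum_const, Finset.card_univ, Fintype.card_fin, nsmul_eq_mul,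
    ENNReal.ofReal_mul (Nat.cast_nonneg m), ENNReal.ofReal_natCast]

/-! ### Markov and Chernoff bounds for i.i.d. samples -/

/-- Markov's inequality. The event is strict so that mean 0 (the sum vanishes almost surely) and
mean ∞ (the event is empty) are covered too. -/
theorem sampleLaw_sum_gt_le {μ : Measure ℝ} [IsProbabilityMeasure μ] (m : ℕ) {φ : ℝ → ℝ≥0∞}
    (hφ : AEMeasurable φ μ) {r : ℝ} (hr : 0 < r) :
    sampleLaw μ m {x | ENNReal.ofReal r⁻¹ * (m * ∫⁻ t, φ t ∂μ) < ∑ i, φ (x i)} ≤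
      ENNReal.ofReal r := by
  have hmp : ∀ i : Fin m, MeasurePreserving (Function.eval i) (sampleLaw μ m) μ :=
    fun i => measurePreserving_eval (fun _ : Fin m => μ) i
  have hmeas : ∀ i : Fin m, AEMeasurable (fun x : Fin m → ℝ => φ (x i)) (sampleLaw μ m) := fun i =>
    hφ.comp_quasiMeasurePreserving (hmp i).quasiMeasurePreserving
  have hsm : AEMeasurable (fun x : Fin m → ℝ => ∑ i, φ (x i)) (sampleLaw μ m) :=
    Finset.aemeasurable_fun_sum _ fun i _ => hmeas i
  have hint : ∫⁻ x, ∑ i, φ (x i) ∂sampleLaw μ m = m * ∫⁻ t, φ t ∂μ := by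
    rw [lintegral_finsetSum' _ fun i _ => hmeas i]
    have : ∀ i : Fin m, ∫⁻ x, φ (x i) ∂sampleLaw μ m = ∫⁻ t, φ t ∂μ := fun i => by
      conv_rhs => rw [← (hmp i).map_eq]
      rw [lintegral_map' ((hmp i).map_eq.symm ▸ hφ) (hmp i).aemeasurable]
    simp [this]
  set J := (m : ℝ≥0∞) * ∫⁻ t, φ t ∂μ with hJ
  have hr' : ENNReal.ofReal r ≠ 0 := by simpa using hr
  have hrr : ENNReal.ofReal r * ENNReal.ofReal r⁻¹ = 1 := by
    rw [ENNReal.ofReal_inv_of_pos hr, ENNReal.mul_inv_cancel hr' ENNReal.ofReal_ne_top]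
  have hri : ENNReal.ofReal r⁻¹ ≠ 0 := by simpa using hr
  rcases eq_or_ne J 0 with h0 | h0
  · rw [h0, lintegral_eq_zero_iff' hsm] at hint
    refine le_of_eq_of_le ?_ zero_le
    refine measure_mono_null (fun x hx => ?_) (ae_iff.1 hint)
    rw [h0, mul_zero] at hx
    exact hx.ne'
  rcases eq_or_ne J ⊤ with h1 | h1
  · rw [h1, ENNReal.mul_top hri]
    simp
  calc sampleLaw μ m {x | ENNReal.ofReal r⁻¹ * J < ∑ i, φ (x i)}
      ≤ sampleLaw μ m {x | ENNReal.ofReal r⁻¹ * J ≤ ∑ i, φ (x i)} :=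
        measure_mono fun x hx => by
          simp only [Set.mem_ofPred_eq] at hx ⊢
          exact hx.le
    _ ≤ (∫⁻ x, ∑ i, φ (x i) ∂sampleLaw μ m) / (ENNReal.ofReal r⁻¹ * J) :=
        meas_ge_le_lintegral_div hsm (mul_ne_zero hri h0)
          (ENNReal.mul_ne_top ENNReal.ofReal_ne_top h1)
    _ ≤ ENNReal.ofReal r := by
        rw [hint]
        refine ENNReal.div_le_of_le_mul ?_
        rw [← mul_assoc, hrr, one_mul]

theorem exp_neg_le_one_sub_half {x : ℝ} (h0 : 0 ≤ x) (h1 : x ≤ 1) :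
    Real.exp (-x) ≤ 1 - x / 2 := by
  have h := convexOn_exp.2 (Set.mem_univ (0 : ℝ)) (Set.mem_univ (-1 : ℝ)) (sub_nonneg.2 h1) h0
    (by ring)
  simp only [smul_eq_mul, mul_zero, zero_add, mul_neg, mul_one, Real.exp_zero] at h
  have he : Real.exp (-1) ≤ 1 / 2 := by
    have := Real.exp_neg_one_lt_d9
    linarith
  nlinarith

/-- Chernoff's lower tail at parameter 1: the chord bound e^{-y} ≤ 1 - y/2 gives each factor
expectation at most e^{-q/2}. Markov at level e^{-mq/4} costs half of the exponent. -/
theorem sampleLaw_sum_le_le_exp {μ : Measure ℝ} [IsProbabilityMeasure μ] (m : ℕ) {Y : ℝ → ℝ}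
    (hY : Measurable Y) (h0 : ∀ x, 0 ≤ Y x) (h1 : ∀ x, Y x ≤ 1) {q : ℝ}
    (hq : ENNReal.ofReal q ≤ ∫⁻ x, ENNReal.ofReal (Y x) ∂μ) :
    sampleLaw μ m {x | ∑ i, Y (x i) ≤ m * q / 4} ≤ ENNReal.ofReal (Real.exp (-(m * q / 4))) := by
  have hYi : Integrable Y μ := Integrable.of_bound hY.aestronglyMeasurable 1
    (Filter.Eventually.of_forall fun x => by rw [Real.norm_of_nonneg (h0 x)]; exact h1 x)
  have hei : Integrable (fun x => Real.exp (-Y x)) μ :=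
    Integrable.of_bound (by fun_prop) 1
      (Filter.Eventually.of_forall fun x => by
        rw [Real.norm_of_nonneg (Real.exp_nonneg _), Real.exp_le_one_iff]
        linarith [h0 x])
  have hq' : q ≤ ∫ x, Y x ∂μ := by
    rw [← ofReal_integral_eq_lintegral_ofReal hYi (Filter.Eventually.of_forall h0)] at hq
    exact (ENNReal.ofReal_le_ofReal_iff (integral_nonneg h0)).1 hq
  have hmgf : ∫ x, Real.exp (-Y x) ∂μ ≤ Real.exp (-(q / 2)) := by
    calc ∫ x, Real.exp (-Y x) ∂μ ≤ ∫ x, (1 - Y x / 2) ∂μ :=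
          integral_mono hei ((integrable_const _).sub (hYi.div_const 2))
            fun x => exp_neg_le_one_sub_half (h0 x) (h1 x)
      _ = 1 - (∫ x, Y x ∂μ) / 2 := by
          rw [integral_sub (integrable_const _) (hYi.div_const 2), integral_div]; simp
      _ ≤ -(q / 2) + 1 := by linarith
      _ ≤ _ := Real.add_one_le_exp _
  have hprod : ∫ x : Fin m → ℝ, ∏ i, Real.exp (-Y (x i)) ∂sampleLaw μ m ≤
      Real.exp (-(m * q / 2)) := by
    rw [sampleLaw, integral_fintype_prod_eq_pow (fun t => Real.exp (-Y t)), Fintype.card_fin]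
    refine (pow_le_pow_left₀ (integral_nonneg fun x => Real.exp_nonneg _) hmgf m).trans ?_
    rw [← Real.exp_nat_mul]
    exact le_of_eq (by congr 1; ring)
  have hpi : Integrable (fun x : Fin m → ℝ => ∏ i, Real.exp (-Y (x i))) (sampleLaw μ m) :=
    Integrable.fintype_prod (f := fun (_ : Fin m) t => Real.exp (-Y t)) fun _ => hei
  have hmarkov := mul_meas_ge_le_integral_of_nonneg
    (Filter.Eventually.of_forall fun x => Finset.prod_nonneg fun i _ => Real.exp_nonneg _)
    hpi (Real.exp (-(m * q / 4)))
  have : IsProbabilityMeasure (sampleLaw μ m) := by unfold sampleLaw; infer_instance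
  have hset : {x : Fin m → ℝ | ∑ i, Y (x i) ≤ m * q / 4} ⊆
      {x | Real.exp (-(m * q / 4)) ≤ ∏ i, Real.exp (-Y (x i))} := by
    intro x hx
    simp only [Set.mem_ofPred_eq] at hx ⊢
    rw [← Real.exp_sum, Real.exp_le_exp, Finset.sum_neg_distrib]
    linarith
  have hreal : (sampleLaw μ m).real {x | Real.exp (-(m * q / 4)) ≤ ∏ i, Real.exp (-Y (x i))} ≤
      Real.exp (-(m * q / 4)) := by
    have h := hmarkov.trans hprod
    have e : Real.exp (-(m * q / 2)) = Real.exp (-(m * q / 4)) * Real.exp (-(m * q / 4)) := by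
      rw [← Real.exp_add]; congr 1; ring
    rw [e] at h
    exact le_of_mul_le_mul_left h (Real.exp_pos _)
  refine (measure_mono hset).trans ?_
  rw [← ofReal_measureReal]
  exact ENNReal.ofReal_le_ofReal hreal

/-- Chernoff for the weight restricted to the cell and divided by B. Its mean is (b-a)/(2B) because
the weight converts the sampling measure back to the uniform one. -/
theorem sampleLaw_cell_le {β : ℝ} (hβ : -1 < β) (m : ℕ) {a b B : ℝ}
    (hdom : Set.Ico a b ⊆ dom) (hB0 : 0 < B) (hB : ∀ x ∈ Set.Ico a b, jacobiWeight β x ≤ B) :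
    sampleLaw (jacobi β) m
      {x | ∑ i, (Set.Ico a b).indicator (jacobiWeight β) (x i) ≤ m * (b - a) / 8} ≤
      ENNReal.ofReal (Real.exp (-(m * ((b - a) / B) / 8))) := by
  have := isProbabilityMeasure_jacobi hβ
  have h := sampleLaw_sum_le_le_exp (μ := jacobi β) m
    (Y := fun x => (Set.Ico a b).indicator (jacobiWeight β) x / B) (q := (b - a) / (2 * B))
    (((measurable_jacobiWeight β).indicator measurableSet_Ico).div_const B)
    (fun x => div_nonneg (Set.indicator_nonneg
      (fun y hy => (jacobiWeight_pos hβ (hdom hy)).le) x) hB0.le)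
    (fun x => (div_le_one hB0).2 (Set.indicator_le' hB (fun _ _ => hB0.le) x)) ?_
  · refine (measure_mono fun x hx => ?_).trans (h.trans (le_of_eq ?_))
    · simp only [Set.mem_ofPred_eq] at hx ⊢
      rw [← Finset.sum_div, div_le_iff₀ hB0]
      refine hx.trans (le_of_eq ?_)
      field_simp
      ring
    · congr 3
      ring
  · have e : ∀ x, ENNReal.ofReal ((Set.Ico a b).indicator (jacobiWeight β) x / B) =
        ENNReal.ofReal (jacobiWeight β x) *
          (Set.Ico a b).indicator (fun _ => ENNReal.ofReal B⁻¹) x := by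
      intro x
      by_cases hx : x ∈ Set.Ico a b
      · rw [Set.indicator_of_mem hx, Set.indicator_of_mem hx, div_eq_mul_inv,
          ENNReal.ofReal_mul (jacobiWeight_pos hβ (hdom hx)).le]
      · rw [Set.indicator_of_notMem hx, Set.indicator_of_notMem hx]; simp
    simp_rw [e]
    rw [lintegral_jacobiWeight_mul hβ, lintegral_indicator_const measurableSet_Ico, unif_eq,
      Measure.smul_apply, Measure.restrict_apply measurableSet_Ico, Set.inter_eq_left.2 hdom,
      Real.volume_Ico, smul_eq_mul, show (2⁻¹ : ℝ≥0∞) = ENNReal.ofReal 2⁻¹ by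
        rw [ENNReal.ofReal_inv_of_pos two_pos]; simp,
      ← ENNReal.ofReal_mul (by norm_num), ← ENNReal.ofReal_mul (by positivity)]
    refine ENNReal.ofReal_le_ofReal (le_of_eq ?_)
    field_simp

/-! ### Complex polynomials in L² and L^∞ -/

theorem eLpNorm_two_sq {α E : Type*} [MeasurableSpace α] [NormedAddCommGroup E] (f : α → E)
    (μ : Measure α) : eLpNorm f 2 μ ^ 2 = ∫⁻ x, ‖f x‖ₑ ^ 2 ∂μ := by
  have := eLpNorm_nnreal_pow_eq_lintegral (f := f) (μ := μ) (p := 2) two_ne_zero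
  simpa using this

theorem exists_re_im {n : ℕ} (hn : 1 ≤ n) {p : ℂ[X]} (hp : p ∈ polySpace n) :
    ∃ a ∈ degreeLT ℝ n, ∃ b ∈ degreeLT ℝ n,
      ∀ x : ℝ, ‖p.eval (x : ℂ)‖ ^ 2 = a.eval x ^ 2 + b.eval x ^ 2 := by
  have hdeg : p.natDegree < n := by
    rcases eq_or_ne p 0 with rfl | h
    · rw [natDegree_zero]; omega
    · exact (natDegree_lt_iff_degree_lt h).2 (mem_degreeLT.1 hp)
  have hmem : ∀ f : ℕ → ℝ, ∑ i ∈ Finset.range n, C (f i) * X ^ i ∈ degreeLT ℝ n := fun f =>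
    Submodule.sum_mem _ fun i hi => mem_degreeLT.2
      ((degree_C_mul_X_pow_le i (f i)).trans_lt (by exact_mod_cast Finset.mem_range.1 hi))
  refine ⟨_, hmem fun i => (p.coeff i).re, _, hmem fun i => (p.coeff i).im, fun x => ?_⟩
  have h1 : (p.eval (x : ℂ)).re = (∑ i ∈ Finset.range n, C (p.coeff i).re * X ^ i).eval x := by
    rw [eval_eq_sum_range' hdeg, Complex.re_sum, eval_finsetSum]
    refine Finset.sum_congr rfl fun i _ => ?_
    rw [← Complex.ofReal_pow, Complex.re_mul_ofReal]
    simp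
  have h2 : (p.eval (x : ℂ)).im = (∑ i ∈ Finset.range n, C (p.coeff i).im * X ^ i).eval x := by
    rw [eval_eq_sum_range' hdeg, Complex.im_sum, eval_finsetSum]
    refine Finset.sum_congr rfl fun i _ => ?_
    rw [← Complex.ofReal_pow, Complex.im_mul_ofReal]
    simp
  rw [← h1, ← h2, Complex.sq_norm, Complex.normSq_apply]
  ring

theorem continuous_eval_ofReal (p : ℂ[X]) : Continuous fun x : ℝ => p.eval (x : ℂ) :=
  p.continuous.comp Complex.continuous_ofReal

theorem lintegral_unif_polynomial {q : ℝ[X]} (hq : ∀ x, 0 ≤ q.eval x) :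
    ∫⁻ x, ENNReal.ofReal (q.eval x) ∂unif = ENNReal.ofReal (polyInt q / 2) := by
  have hint : IntegrableOn (fun x => q.eval x) dom :=
    (q.continuous.integrableOn_Icc (a := -1) (b := 1)).mono_set Set.Ioo_subset_Icc_self
  rw [lintegral_unif, ← ofReal_integral_eq_lintegral_ofReal hint
    (Filter.Eventually.of_forall hq), polyInt_apply,
    intervalIntegral.integral_of_le (by norm_num), integral_Ioc_eq_integral_Ioo, div_eq_inv_mul,
    ENNReal.ofReal_mul (by norm_num), ENNReal.ofReal_inv_of_pos two_pos]
  simp [dom]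

theorem exists_polynomial_norm {n : ℕ} (hn : 1 ≤ n) {p : ℂ[X]} (hp : p ∈ polySpace n) :
    ∃ a ∈ degreeLT ℝ n, ∃ b ∈ degreeLT ℝ n, ∃ t : ℝ, 0 ≤ t ∧
      (∀ x : ℝ, ‖p.eval (x : ℂ)‖ ^ 2 = a.eval x ^ 2 + b.eval x ^ 2) ∧
      eLpNorm (fun x : ℝ => p.eval (x : ℂ)) 2 unif = ENNReal.ofReal t ∧
      2 * t ^ 2 = polyInt (a * a) + polyInt (b * b) := by
  obtain ⟨a, ha, b, hb, hab⟩ := exists_re_im hn hp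
  have h0 : 0 ≤ (polyInt (a * a) + polyInt (b * b)) / 2 := by
    have := polyInt_sq_nonneg a
    have := polyInt_sq_nonneg b
    positivity
  refine ⟨a, ha, b, hb, √((polyInt (a * a) + polyInt (b * b)) / 2), Real.sqrt_nonneg _, hab, ?_, ?_⟩
  · have h : eLpNorm (fun x : ℝ => p.eval (x : ℂ)) 2 unif ^ 2 =
        ENNReal.ofReal √((polyInt (a * a) + polyInt (b * b)) / 2) ^ 2 := by
      rw [eLpNorm_two_sq, ← ENNReal.ofReal_pow (Real.sqrt_nonneg _), Real.sq_sqrt h0, ← map_add,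
        ← lintegral_unif_polynomial fun x => by
          rw [eval_add, eval_mul, eval_mul]
          exact add_nonneg (mul_self_nonneg _) (mul_self_nonneg _)]
      refine lintegral_congr fun x => ?_
      rw [← ofReal_norm, ← ENNReal.ofReal_pow (norm_nonneg _), hab, eval_add, eval_mul,
        eval_mul, sq, sq]
    exact (ENNReal.pow_right_strictMono two_ne_zero).injective h
  · rw [Real.sq_sqrt h0]; ring

/-- The real `L²` norm of a polynomial with respect to the uniform probability measure. -/
noncomputable def polyNorm (p : ℂ[X]) : ℝ := (eLpNorm (fun x : ℝ => p.eval (x : ℂ)) 2 unif).toReal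

theorem polyNorm_nonneg (p : ℂ[X]) : 0 ≤ polyNorm p := ENNReal.toReal_nonneg

theorem eLpNorm_eq_polyNorm {n : ℕ} (hn : 1 ≤ n) {p : ℂ[X]} (hp : p ∈ polySpace n) :
    eLpNorm (fun x : ℝ => p.eval (x : ℂ)) 2 unif = ENNReal.ofReal (polyNorm p) := by
  obtain ⟨a, -, b, -, t, -, -, h, -⟩ := exists_polynomial_norm hn hp
  rw [polyNorm, h, ENNReal.ofReal_toReal ENNReal.ofReal_ne_top]

/-- Nikolskii for the real and imaginary parts; the factor 2 appears because the uniform probability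
measure is half of Lebesgue measure. -/
theorem norm_eval_sq_le {n : ℕ} (hn : 1 ≤ n) {p : ℂ[X]} (hp : p ∈ polySpace n) {x : ℝ}
    (hx : x ∈ Set.Icc (-1 : ℝ) 1) :
    ‖p.eval (x : ℂ)‖ ^ 2 ≤ 2 * n ^ 2 * polyNorm p ^ 2 := by
  obtain ⟨a, ha, b, hb, t, ht, hab, h, h2⟩ := exists_polynomial_norm hn hp
  have e : polyNorm p = t := by rw [polyNorm, h, ENNReal.toReal_ofReal ht]
  have h3 := (nikolskii_and_bernstein n a ha).1 x hx
  have h4 := (nikolskii_and_bernstein n b hb).1 x hx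
  rw [e, hab]
  calc _ ≤ _ := add_le_add h3 h4
    _ = n ^ 2 * (2 * t ^ 2) := by rw [h2]; ring
    _ = _ := by ring

theorem eLpNorm_top_le {n : ℕ} (hn : 1 ≤ n) {p : ℂ[X]} (hp : p ∈ polySpace n) :
    eLpNorm (fun x : ℝ => p.eval (x : ℂ)) ⊤ unif ≤ ENNReal.ofReal (√2 * n * polyNorm p) := by
  rw [eLpNorm_exponent_top]
  refine eLpNormEssSup_le_of_ae_bound
    (ae_unif_iff.2 ((ae_restrict_mem measurableSet_dom).mono fun x hx => ?_))
  have h0 := polyNorm_nonneg p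
  refine abs_le_of_sq_le_sq' ?_ (by positivity) |>.2
  rw [mul_pow, mul_pow, Real.sq_sqrt zero_le_two]
  exact norm_eval_sq_le hn hp (Set.Ioo_subset_Icc_self hx)

theorem eq_zero_of_polyNorm_eq_zero {n : ℕ} (hn : 1 ≤ n) {p : ℂ[X]} (hp : p ∈ polySpace n)
    (h : polyNorm p = 0) : p = 0 := by
  have hroot : ∀ x ∈ Set.Icc (-1 : ℝ) 1, p.IsRoot (x : ℂ) := fun x hx => by
    have := norm_eval_sq_le hn hp hx
    rw [h] at this
    have h0 : ‖p.eval (x : ℂ)‖ ^ 2 ≤ 0 := this.trans_eq (by ring)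
    exact norm_eq_zero.1 (pow_eq_zero_iff two_ne_zero |>.1 (le_antisymm h0 (sq_nonneg _)))
  refine Polynomial.eq_zero_of_infinite_isRoot p
    (((Set.Icc_infinite (by norm_num : (-1 : ℝ) < 1)).image
      Complex.ofReal_injective.injOn).mono ?_)
  rintro _ ⟨x, hx, rfl⟩
  exact hroot x hx

theorem memLp_eval (p : ℂ[X]) : MemLp (fun x : ℝ => p.eval (x : ℂ)) 2 unif := by
  obtain ⟨M, hM⟩ := (isCompact_Icc (a := (-1 : ℝ)) (b := 1)).exists_bound_of_continuousOn
    (continuous_eval_ofReal p).continuousOn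
  exact MemLp.of_bound (continuous_eval_ofReal p).aestronglyMeasurable M
    (ae_unif_iff.2 ((ae_restrict_mem measurableSet_dom).mono fun x hx =>
      hM x (Set.Ioo_subset_Icc_self hx)))

/-! ### Best approximation, least squares and error bounds -/

/-- Existence and uniqueness of the best approximation from the image of an injective linear map
on a finite-dimensional space. -/
theorem exists_unique_minimizer {V H : Type*} [AddCommGroup V] [Module ℂ V] [FiniteDimensional ℂ V]
    [NormedAddCommGroup H] [InnerProductSpace ℂ H] (T : V →ₗ[ℂ] H) (hT : Function.Injective T)
    (h : H) :
    ∃ v, (∀ u, ‖h - T v‖ ≤ ‖h - T u‖) ∧ ∀ v', (∀ u, ‖h - T v'‖ ≤ ‖h - T u‖) → v' = v := by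
  let K := LinearMap.range T
  obtain ⟨v, hv⟩ : K.starProjection h ∈ K := K.starProjection_apply_mem h
  -- Pythagoras around the orthogonal projection gives minimality and, with injectivity, uniqueness.
  have horth : ∀ u, ‖h - T u‖ ^ 2 = ‖h - T v‖ ^ 2 + ‖T v - T u‖ ^ 2 := by
    intro u
    have h0 : inner ℂ (h - T v) (T v - T u) = 0 := by
      rw [hv]
      refine (Submodule.mem_orthogonal' K _).1 (Submodule.sub_starProjection_mem_orthogonal h) _ ?_
      exact K.sub_mem (K.starProjection_apply_mem h) ⟨u, rfl⟩
    have := norm_add_sq_eq_norm_sq_add_norm_sq_of_inner_eq_zero _ _ h0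
    rw [sub_add_sub_cancel] at this
    simpa only [sq] using this
  refine ⟨v, fun u => ?_, fun v' hv' => ?_⟩
  · refine abs_le_of_sq_le_sq' ?_ (norm_nonneg _) |>.2
    rw [horth u]
    linarith [sq_nonneg ‖T v - T u‖]
  · have h1 := pow_le_pow_left₀ (norm_nonneg _) (hv' v) 2
    rw [horth v'] at h1
    have h2 : ‖T v - T v'‖ = 0 := by
      have : ‖T v - T v'‖ ^ 2 ≤ 0 := by linarith
      exact pow_eq_zero_iff two_ne_zero |>.1 (le_antisymm this (sq_nonneg _))
    exact (hT (sub_eq_zero.1 (norm_eq_zero.1 h2))).symm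

instance (n : ℕ) : FiniteDimensional ℂ (polySpace n) :=
  Module.Finite.equiv (degreeLTEquiv ℂ n).symm

theorem exists_unique_bestApprox {n : ℕ} (hn : 1 ≤ n) {f : ℝ → ℂ} (hf : MemLp f 2 unif) :
    ∃ g : ℂ[X], IsBestApprox n f g ∧ ∀ q, IsBestApprox n f q → q = g := by
  let T : polySpace n →ₗ[ℂ] Lp ℂ 2 unif :=
    { toFun := fun p => (memLp_eval (p : ℂ[X])).toLp
      map_add' := fun p q => by
        rw [← MemLp.toLp_add]
        congr 1
        ext x
        simp
      map_smul' := fun c p => by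
        rw [RingHom.id_apply, ← MemLp.toLp_const_smul]
        congr 1
        ext x
        simp }
  have hT : Function.Injective T := by
    rw [injective_iff_map_eq_zero]
    intro p hp
    have h1 : ‖T p‖ = polyNorm (p : ℂ[X]) := Lp.norm_toLp _ (memLp_eval (p : ℂ[X]))
    rw [hp, norm_zero] at h1
    exact Subtype.ext (eq_zero_of_polyNorm_eq_zero hn p.2 h1.symm)
  have herr : ∀ p : polySpace n, err 2 f p = ENNReal.ofReal ‖hf.toLp - T p‖ := by
    intro p
    have : hf.toLp - T p = (hf.sub (memLp_eval (p : ℂ[X]))).toLp := rfl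
    rw [this, ofReal_norm, Lp.enorm_toLp]
    rfl
  have hiff : ∀ p q : polySpace n,
      err 2 f p ≤ err 2 f q ↔ ‖hf.toLp - T p‖ ≤ ‖hf.toLp - T q‖ := fun p q => by
    rw [herr, herr, ENNReal.ofReal_le_ofReal_iff (norm_nonneg _)]
  obtain ⟨v, hv, huniq⟩ := exists_unique_minimizer T hT hf.toLp
  refine ⟨v, ⟨v.2, fun q hq => (hiff v ⟨q, hq⟩).2 (hv _)⟩, fun q hq => ?_⟩
  exact congrArg Subtype.val (huniq ⟨q, hq.1⟩ fun u => (hiff ⟨q, hq.1⟩ u).1 (hq.2 u u.2))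

/-- The functional is a squared Euclidean distance to the image of the scaled sampling map, and
stability makes that map injective. Since the minimizer fits the data no worse than g does, its
image is within twice the residual of g; 32 = 8 · 2². -/
theorem exists_unique_estimator {n m : ℕ} (hn : 1 ≤ n) {μ : Measure ℝ} {x : Fin m → ℝ}
    (hw : ∀ i, 0 ≤ weight μ (x i))
    (hstab : ∀ p ∈ polySpace n, polyNorm p ^ 2 ≤ 8 * lsObjective μ x 0 p) (y : Fin m → ℂ) :
    ∃ p, IsEstimator μ n x y p ∧ (∀ q, IsEstimator μ n x y q → q = p) ∧
      ∀ g ∈ polySpace n, polyNorm (p - g) ^ 2 ≤ 32 * lsObjective μ x y g := by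
  let r : Fin m → ℂ := fun i => (√(1 / (m : ℝ) * weight μ (x i)) : ℝ)
  let T : polySpace n →ₗ[ℂ] EuclideanSpace ℂ (Fin m) :=
    { toFun := fun p => WithLp.toLp 2 fun i => r i * (p : ℂ[X]).eval (x i : ℂ)
      map_add' := fun p q => by
        ext i
        simp [mul_add]
      map_smul' := fun c p => by
        ext i
        simp [mul_left_comm] }
  have hobj : ∀ (z : Fin m → ℂ) (p : polySpace n),
      lsObjective μ x z p = ‖WithLp.toLp 2 (fun i => r i * z i) - T p‖ ^ 2 := by
    intro z p
    rw [EuclideanSpace.norm_sq_eq, lsObjective, Finset.mul_sum]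
    refine Finset.sum_congr rfl fun i _ => ?_
    have : (WithLp.toLp 2 (fun i => r i * z i) - T p).ofLp i =
        r i * (z i - (p : ℂ[X]).eval (x i : ℂ)) := by
      simp [T, mul_sub]
    rw [this, norm_mul, mul_pow, Complex.norm_real, Real.norm_of_nonneg (Real.sqrt_nonneg _),
      Real.sq_sqrt (mul_nonneg (by positivity) (hw i)), mul_assoc]
  have hobj0 : ∀ p : polySpace n, lsObjective μ x 0 p = ‖T p‖ ^ 2 := fun p => by
    rw [hobj, ← norm_neg]
    congr 2
    ext i
    simp
  have hT : Function.Injective T := by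
    rw [injective_iff_map_eq_zero]
    intro p hp
    have := hstab p p.2
    rw [hobj0, hp, norm_zero] at this
    refine Subtype.ext (eq_zero_of_polyNorm_eq_zero hn p.2 ?_)
    exact pow_eq_zero_iff two_ne_zero |>.1 (le_antisymm (by simpa using this) (sq_nonneg _))
  set h : EuclideanSpace ℂ (Fin m) := WithLp.toLp 2 (fun i => r i * y i) with hh
  have hiff : ∀ p q : polySpace n,
      lsObjective μ x y p ≤ lsObjective μ x y q ↔ ‖h - T p‖ ≤ ‖h - T q‖ := fun p q => by
    rw [hobj, hobj, sq_le_sq₀ (norm_nonneg _) (norm_nonneg _)]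
  obtain ⟨v, hv, huniq⟩ := exists_unique_minimizer T hT h
  refine ⟨v, ⟨v.2, fun q hq => (hiff v ⟨q, hq⟩).2 (hv _)⟩, fun q hq => ?_, fun g hg => ?_⟩
  · exact congrArg Subtype.val (huniq ⟨q, hq.1⟩ fun u => (hiff ⟨q, hq.1⟩ u).1 (hq.2 u u.2))
  · have h1 := hstab (v - g) (Submodule.sub_mem _ v.2 hg)
    have h2 := hobj0 (v - ⟨g, hg⟩)
    have h3 := hobj y ⟨g, hg⟩
    have h4 : ‖T (v - ⟨g, hg⟩)‖ ≤ 2 * ‖h - T ⟨g, hg⟩‖ := by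
      rw [map_sub]
      have := norm_sub_le_norm_sub_add_norm_sub (T v) h (T ⟨g, hg⟩)
      have h5 := hv ⟨g, hg⟩
      rw [norm_sub_rev] at h5
      linarith
    have h6 := pow_le_pow_left₀ (norm_nonneg _) h4 2
    simp only [Submodule.coe_sub] at h2
    rw [h3, ← hh]
    rw [h2] at h1
    nlinarith

/-- The averaging factor 1/m cancels the m in the crude bound on single weights, so the noise is
amplified only by a multiple of 1/ε. -/
theorem lsObjective_noisy_le {μ : Measure ℝ} {m : ℕ} (hm : 1 ≤ m) {ε η : ℝ} (hε : 0 < ε)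
    (hη : 0 ≤ η) {x : Fin m → ℝ} {f : ℝ → ℂ} {g : ℂ[X]} (hw : ∀ i, 0 ≤ weight μ (x i))
    (hA : ∑ i, weight μ (x i) * ‖f (x i) - g.eval (x i : ℂ)‖ ^ 2 ≤ 3 * m / ε * η ^ 2)
    (hB : ∀ i, weight μ (x i) ≤ 3 * m / ε) (e : EuclideanSpace ℂ (Fin m)) :
    lsObjective μ x (fun i => f (x i) + e i) g ≤ 6 / ε * (η + ‖e‖) ^ 2 := by
  have hm0 : (0 : ℝ) < m := by exact_mod_cast hm
  have hE : ∑ i, weight μ (x i) * ‖e i‖ ^ 2 ≤ 3 * m / ε * ‖e‖ ^ 2 := by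
    rw [EuclideanSpace.norm_sq_eq, Finset.mul_sum]
    exact Finset.sum_le_sum fun i _ => mul_le_mul_of_nonneg_right (hB i) (sq_nonneg _)
  have hsum : ∑ i, weight μ (x i) * ‖f (x i) + e i - g.eval (x i : ℂ)‖ ^ 2 ≤
      2 * ∑ i, weight μ (x i) * ‖f (x i) - g.eval (x i : ℂ)‖ ^ 2 +
        2 * ∑ i, weight μ (x i) * ‖e i‖ ^ 2 := by
    rw [Finset.mul_sum, Finset.mul_sum, ← Finset.sum_add_distrib]
    refine Finset.sum_le_sum fun i _ => ?_
    have h1 : ‖f (x i) + e i - g.eval (x i : ℂ)‖ ≤ ‖f (x i) - g.eval (x i : ℂ)‖ + ‖e i‖ := by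
      rw [add_sub_right_comm]
      exact norm_add_le _ _
    have h2 := pow_le_pow_left₀ (norm_nonneg _) h1 2
    have h3 : ‖f (x i) + e i - g.eval (x i : ℂ)‖ ^ 2 ≤
        2 * ‖f (x i) - g.eval (x i : ℂ)‖ ^ 2 + 2 * ‖e i‖ ^ 2 := by
      nlinarith [sq_nonneg (‖f (x i) - g.eval (x i : ℂ)‖ - ‖e i‖)]
    calc _ ≤ _ := mul_le_mul_of_nonneg_left h3 (hw i)
      _ = _ := by ring
  calc lsObjective μ x (fun i => f (x i) + e i) g
      ≤ 1 / (m : ℝ) * (2 * (3 * m / ε * η ^ 2) + 2 * (3 * m / ε * ‖e‖ ^ 2)) :=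
        mul_le_mul_of_nonneg_left (hsum.trans (by linarith)) (by positivity)
    _ = 6 / ε * (η ^ 2 + ‖e‖ ^ 2) := by field_simp; ring
    _ ≤ _ := mul_le_mul_of_nonneg_left (by nlinarith [norm_nonneg e]) (by positivity)

/-- Triangle inequality through g. As 32 · 6 = 192 ≤ 14², the L² distance of p and g is at most
14/√ε times the data error. Then 20 suffices: 1 + 14 ≤ 20 in L², where n ≥ 1 is given away, and √2 ·
14 ≤ 20 in sup norm. -/
theorem err_bounds {n : ℕ} (hn : 1 ≤ n) {ε η : ℝ} (hε : 0 < ε) (hε1 : ε < 1)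
    (hη : 0 ≤ η) {f : ℝ → ℂ} (hf : MemLp f 2 unif) {p g : ℂ[X]} (hp : p ∈ polySpace n)
    (hg : g ∈ polySpace n) (hfg : err 2 f g = ENNReal.ofReal η)
    {E : Type*} [NormedAddCommGroup E] (e : E)
    (h : polyNorm (p - g) ^ 2 ≤ 32 * (6 / ε * (η + ‖e‖) ^ 2)) :
    err 2 f p ≤ ENNReal.ofReal (20 * (n / √ε)) * (err 2 f g + ‖e‖ₑ) ∧
    err ⊤ f p ≤ ENNReal.ofReal 20 *
      (err ⊤ f g + ENNReal.ofReal (n / √ε) * (err 2 f g + ‖e‖ₑ)) := by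
  have hn0 : (1 : ℝ) ≤ n := by exact_mod_cast hn
  have hs0 : 0 < √ε := Real.sqrt_pos.2 hε
  have hs1 : √ε ≤ 1 := Real.sqrt_le_one.2 hε1.le
  have hsq : √ε ^ 2 = ε := Real.sq_sqrt hε.le
  have hmem : p - g ∈ polySpace n := Submodule.sub_mem _ hp hg
  set t := polyNorm (p - g) with ht
  have ht0 : 0 ≤ t := polyNorm_nonneg _
  set R := η + ‖e‖ with hR
  have hR0 : 0 ≤ R := by positivity
  have htR : t ≤ 14 / √ε * R := by
    refine abs_le_of_sq_le_sq' (h.trans ?_) (by positivity) |>.2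
    rw [mul_pow, div_pow, hsq]
    have : 0 ≤ R ^ 2 / ε := by positivity
    calc 32 * (6 / ε * R ^ 2) = 192 * (R ^ 2 / ε) := by ring
      _ ≤ 196 * (R ^ 2 / ε) := by linarith
      _ = _ := by ring
  have hsum : err 2 f g + ‖e‖ₑ = ENNReal.ofReal R := by
    rw [hfg, ← ofReal_norm, ← ENNReal.ofReal_add hη (norm_nonneg _)]
  have hae : ∀ q : ℂ[X], AEStronglyMeasurable (fun x : ℝ => f x - q.eval (x : ℂ)) unif := fun q =>
    hf.1.sub (continuous_eval_ofReal q).aestronglyMeasurable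
  have htri : ∀ r : ℝ≥0∞, 1 ≤ r → err r f p ≤
      err r f g + eLpNorm (fun x : ℝ => (p - g).eval (x : ℂ)) r unif := by
    intro r hr
    have := eLpNorm_sub_le (hae g) (continuous_eval_ofReal (p - g)).aestronglyMeasurable hr
    have e : (fun x : ℝ => f x - p.eval (x : ℂ)) =
        (fun x : ℝ => f x - g.eval (x : ℂ)) - fun x : ℝ => (p - g).eval (x : ℂ) := by
      ext x
      simp
    rw [← e] at this
    exact this
  have hone : 1 ≤ (n : ℝ) / √ε := by
    rw [le_div_iff₀ hs0]; linarith
  constructor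
  · refine (htri 2 one_le_two).trans ?_
    rw [eLpNorm_eq_polyNorm hn hmem, hsum, hfg, ← ENNReal.ofReal_add hη ht0,
      ← ENNReal.ofReal_mul (by positivity)]
    refine ENNReal.ofReal_le_ofReal ?_
    have h1 : η ≤ 1 * R := by rw [one_mul]; exact le_add_of_nonneg_right (norm_nonneg _)
    have h2 : 1 * R ≤ n / √ε * R := mul_le_mul_of_nonneg_right hone hR0
    have h3 : 14 / √ε * R ≤ 14 * (n / √ε) * R := by
      refine mul_le_mul_of_nonneg_right ?_ hR0
      rw [← mul_div_assoc]
      gcongr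
      linarith
    have h4 : 0 ≤ n / √ε * R := by positivity
    linarith
  · refine (htri ⊤ le_top).trans ?_
    rw [hsum, ← ENNReal.ofReal_mul (by positivity), mul_add]
    refine add_le_add ?_ ((eLpNorm_top_le hn hmem).trans ?_)
    · exact le_mul_of_one_le_left zero_le (by rw [ENNReal.one_le_ofReal]; norm_num)
    · rw [← ENNReal.ofReal_mul (by norm_num)]
      refine ENNReal.ofReal_le_ofReal ?_
      have h2 : √2 ≤ 10 / 7 := by
        rw [Real.sqrt_le_left (by norm_num)]; norm_num
      calc √2 * n * t ≤ 10 / 7 * n * (14 / √ε * R) := by gcongr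
        _ = 20 * (n / √ε * R) := by ring

/-! ### Stability with high probability and the sample count -/

/-- On admissible cells, cell length over maximal weight is at least of order `n^{-(2β+2)}`. -/
theorem exists_cell_constant {β : ℝ} (hβ : -1 / 2 ≤ β) :
    ∃ c : ℝ, 0 < c ∧ ∀ n : ℕ, 1 ≤ n → ∀ a b s : ℝ, 1 / (8 * n) ≤ s → s / (256 * n) ≤ b - a →
      (∀ x ∈ Set.Icc a b, s ^ 2 / 4 ≤ 1 - x ^ 2 ∧ 1 - x ^ 2 ≤ 4 * s ^ 2) →
      ∃ B : ℝ, 0 < B ∧ (∀ x ∈ Set.Ico a b, jacobiWeight β x ≤ B) ∧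
        c ≤ (b - a) / B * (n : ℝ) ^ (2 * β + 2) := by
  have hZ := jacobiMass_pos (show -1 < β by linarith)
  set Z := jacobiMass β with hZd
  have h4 : (0 : ℝ) < 4 ^ |β| := by positivity
  have h8 : (0 : ℝ) < 8 ^ (2 * β + 1) := by positivity
  refine ⟨1 / (128 * Z * 4 ^ |β| * 8 ^ (2 * β + 1)), by positivity, ?_⟩
  intro n hn a b s hs hab hx
  have hn0 : (0 : ℝ) < n := by exact_mod_cast hn
  have hs0 : 0 < s := lt_of_lt_of_le (by positivity) hs
  have hsb : 0 < s ^ (2 * β) := Real.rpow_pos_of_pos hs0 _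
  refine ⟨Z * 4 ^ |β| / (2 * s ^ (2 * β)), by positivity, fun x hxm => ?_, ?_⟩
  · obtain ⟨h1, h2⟩ := hx x (Set.Ico_subset_Icc_self hxm)
    have hp : 0 < 1 - x ^ 2 := lt_of_lt_of_le (by positivity) h1
    have hs2 : s ^ (2 * β) = (s ^ 2) ^ β := by
      rw [Real.rpow_mul hs0.le, Real.rpow_two]
    have key : s ^ (2 * β) ≤ 4 ^ |β| * (1 - x ^ 2) ^ β := by
      rw [hs2]
      rcases le_total 0 β with h | h
      · rw [abs_of_nonneg h, ← Real.mul_rpow (by norm_num) hp.le]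
        exact Real.rpow_le_rpow (by positivity) (by linarith) h
      · rw [abs_of_nonpos h, Real.rpow_neg (by norm_num), ← div_eq_inv_mul,
          ← Real.div_rpow hp.le (by norm_num)]
        exact Real.rpow_le_rpow_of_nonpos (by positivity) (by linarith) h
    have hpb : 0 < (1 - x ^ 2) ^ β := Real.rpow_pos_of_pos hp _
    rw [jacobiWeight, div_le_div_iff₀ (by positivity) (by positivity)]
    calc Z * (2 * s ^ (2 * β)) ≤ Z * (2 * (4 ^ |β| * (1 - x ^ 2) ^ β)) := by gcongr
      _ = _ := by ring
  · have e1 : s / (256 * n) / (Z * 4 ^ |β| / (2 * s ^ (2 * β))) * (n : ℝ) ^ (2 * β + 2) =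
        (s * n) ^ (2 * β + 1) / (128 * Z * 4 ^ |β|) := by
      have : (n : ℝ) ^ (2 * β + 2) = n ^ (2 * β + 1) * n := by
        rw [← Real.rpow_add_one hn0.ne']; congr 1; ring
      rw [this, Real.mul_rpow hs0.le hn0.le, Real.rpow_add_one hs0.ne' (2 * β)]
      field_simp
      norm_num
    -- The smallest value s ~ 1/n is the worst case exactly because 2β + 1 ≥ 0; this is where β ≥
    -- -1/2 matters.
    have e2 : (1 / 8 : ℝ) ^ (2 * β + 1) ≤ (s * n) ^ (2 * β + 1) := by
      refine Real.rpow_le_rpow (by norm_num) ?_ (by linarith)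
      rw [div_le_iff₀ (by positivity)] at hs
      linarith
    rw [Real.div_rpow zero_le_one (by norm_num), Real.one_rpow] at e2
    calc 1 / (128 * Z * 4 ^ |β| * 8 ^ (2 * β + 1))
        = 1 / 8 ^ (2 * β + 1) / (128 * Z * 4 ^ |β|) := by field_simp
      _ ≤ (s * n) ^ (2 * β + 1) / (128 * Z * 4 ^ |β|) := by gcongr
      _ = _ := e1.symm
      _ ≤ _ := by gcongr

theorem polyNorm_sq_le_lsObjective {μ : Measure ℝ} {n m N : ℕ} (hn : 1 ≤ n) (hm : 1 ≤ m)
    {a : ℕ → ℝ} (hmono : ∀ j < N, a j < a (j + 1)) (ha0 : -1 ≤ a 0) (haN : a N ≤ 1)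
    (ha0' : 8 * (n : ℝ) ^ 2 * (a 0 + 1) ≤ 1) (haN' : 8 * (n : ℝ) ^ 2 * (1 - a N) ≤ 1)
    (hmesh : ∀ j < N, ∀ x ∈ Set.Icc (a j) (a (j + 1)),
      64 * (n : ℝ) ^ 2 * (a (j + 1) - a j) ^ 2 ≤ 1 - x ^ 2)
    {x : Fin m → ℝ} (hw : ∀ i, 0 ≤ weight μ (x i))
    (hcell : ∀ j < N, m * (a (j + 1) - a j) / 8 ≤
      ∑ i, (Set.Ico (a j) (a (j + 1))).indicator (fun _ => weight μ (x i)) (x i))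
    {p : ℂ[X]} (hp : p ∈ polySpace n) :
    polyNorm p ^ 2 ≤ 8 * lsObjective μ x 0 p := by
  have hm0 : (0 : ℝ) < m := by exact_mod_cast hm
  obtain ⟨u, hu, v, hv, t, ht, huv, h, h2⟩ := exists_polynomial_norm hn hp
  have e : polyNorm p = t := by rw [polyNorm, h, ENNReal.toReal_ofReal ht]
  have hmz : ∀ q ∈ degreeLT ℝ n, polyInt (q * q) ≤
      2 * 8 * ∑ i, weight μ (x i) / m * q.eval (x i) ^ 2 := fun q hq =>
    marcinkiewicz_zygmund hn hmono ha0 haN ha0' haN' hmesh x _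
      (fun i => div_nonneg (hw i) hm0.le) (by norm_num) (fun j hj => by
        have h3 := hcell j hj
        have h4 : ∑ i, (Set.Ico (a j) (a (j + 1))).indicator (fun _ => weight μ (x i) / m) (x i) =
            (∑ i, (Set.Ico (a j) (a (j + 1))).indicator (fun _ => weight μ (x i)) (x i)) / m := by
          rw [Finset.sum_div]
          refine Finset.sum_congr rfl fun i _ => ?_
          by_cases hx : x i ∈ Set.Ico (a j) (a (j + 1))
          · rw [Set.indicator_of_mem hx, Set.indicator_of_mem hx]
          · rw [Set.indicator_of_notMem hx, Set.indicator_of_notMem hx, zero_div]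
        rw [h4, ← mul_div_assoc, le_div_iff₀ hm0]
        linarith) hq
  have h3 := add_le_add (hmz u hu) (hmz v hv)
  have h4 : lsObjective μ x 0 p = (∑ i, weight μ (x i) / m * u.eval (x i) ^ 2) +
      ∑ i, weight μ (x i) / m * v.eval (x i) ^ 2 := by
    rw [lsObjective, Finset.mul_sum, ← Finset.sum_add_distrib]
    refine Finset.sum_congr rfl fun i _ => ?_
    rw [Pi.zero_apply, zero_sub, norm_neg, huv]
    ring
  rw [e, h4]
  linarith

/-- Three failures share ε equally: a large residual of f - g, a large total weight, an
underweighted cell. None involves the noise, so one event serves all e. -/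
theorem quasiBest_of_cells {β : ℝ} (hβ : -1 < β) {n m N : ℕ} (hn : 1 ≤ n) (hm : 1 ≤ m) {ε : ℝ}
    (hε : 0 < ε) (hε1 : ε < 1)
    {a : ℕ → ℝ} (hmono : ∀ j < N, a j < a (j + 1)) (ha0 : -1 ≤ a 0) (haN : a N ≤ 1)
    (ha0' : 8 * (n : ℝ) ^ 2 * (a 0 + 1) ≤ 1) (haN' : 8 * (n : ℝ) ^ 2 * (1 - a N) ≤ 1)
    (hmesh : ∀ j < N, ∀ x ∈ Set.Icc (a j) (a (j + 1)),
      64 * (n : ℝ) ^ 2 * (a (j + 1) - a j) ^ 2 ≤ 1 - x ^ 2)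
    (hprob : ∑ j ∈ Finset.range N, sampleLaw (jacobi β) m
      {x | ∑ i, (Set.Ico (a j) (a (j + 1))).indicator (jacobiWeight β) (x i) ≤
        m * (a (j + 1) - a j) / 8} ≤ ENNReal.ofReal (ε / 3)) :
    QuasiBest 20 (jacobi β) n m ε := by
  intro f hf
  obtain ⟨g, hg, hguniq⟩ := exists_unique_bestApprox hn hf
  refine ⟨g, hg, hguniq, ?_⟩
  have := isProbabilityMeasure_jacobi hβ
  have : IsProbabilityMeasure (sampleLaw (jacobi β) m) := by unfold sampleLaw; infer_instance
  have hm0 : (0 : ℝ) < m := by exact_mod_cast hm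
  have hfg : MemLp (fun x : ℝ => f x - g.eval (x : ℂ)) 2 unif := hf.sub (memLp_eval g)
  set η := (err 2 f g).toReal with hη
  have hη0 : 0 ≤ η := ENNReal.toReal_nonneg
  have hηe : err 2 f g = ENNReal.ofReal η := (ENNReal.ofReal_toReal hfg.2.ne).symm
  have hwm : Measurable fun x => ENNReal.ofReal (jacobiWeight β x) :=
    (measurable_jacobiWeight β).ennreal_ofReal
  set φ : ℝ → ℝ≥0∞ := fun x =>
    ENNReal.ofReal (jacobiWeight β x) * ‖f x - g.eval (x : ℂ)‖ₑ ^ 2 with hφ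
  have hφm : AEMeasurable φ (jacobi β) :=
    hwm.aemeasurable.mul
      ((hfg.1.mono_ac (jacobi_absolutelyContinuous β)).enorm.pow_const 2)
  have hφi : ∫⁻ x, φ x ∂jacobi β = ENNReal.ofReal (η ^ 2) := by
    rw [hφ, lintegral_jacobiWeight_mul hβ, ← eLpNorm_two_sq, ENNReal.ofReal_pow hη0, ← hηe]
    rfl
  have hwi : ∫⁻ x, ENNReal.ofReal (jacobiWeight β x) ∂jacobi β = 1 := by
    have := lintegral_jacobiWeight_mul hβ fun _ => 1
    simpa using this
  have hε3 : 0 < ε / 3 := by positivity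
  have hA := sampleLaw_sum_gt_le (μ := jacobi β) m hφm hε3
  have hB := sampleLaw_sum_gt_le (μ := jacobi β) m hwm.aemeasurable hε3
  rw [hφi] at hA
  rw [hwi] at hB
  set S0 : Set (Fin m → ℝ) :=
    {x | ¬ ∀ i, x i ∈ dom ∧ weight (jacobi β) (x i) = jacobiWeight β (x i)} with hS0
  set SA : Set (Fin m → ℝ) :=
    {x | ENNReal.ofReal (ε / 3)⁻¹ * (m * ENNReal.ofReal (η ^ 2)) < ∑ i, φ (x i)} with hSA
  set SB : Set (Fin m → ℝ) :=
    {x | ENNReal.ofReal (ε / 3)⁻¹ * (m * 1) < ∑ i, ENNReal.ofReal (jacobiWeight β (x i))} with hSB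
  set SC : Set (Fin m → ℝ) := ⋃ j ∈ Finset.range N,
    {x | ∑ i, (Set.Ico (a j) (a (j + 1))).indicator (jacobiWeight β) (x i) ≤
        m * (a (j + 1) - a j) / 8} with hSC
  have hS00 : sampleLaw (jacobi β) m S0 = 0 := by
    have h1 : ∀ᵐ x ∂sampleLaw (jacobi β) m,
        ∀ i, x i ∈ dom ∧ weight (jacobi β) (x i) = jacobiWeight β (x i) :=
      Filter.eventually_all.2 fun i => (Measure.tendsto_eval_ae_ae
        (μ := fun _ : Fin m => jacobi β) (i := i)).eventually
        ((jacobi_absolutelyContinuous β).ae_le (weight_ae_eq hβ))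
    exact ae_iff.1 h1
  set S := S0 ∪ SA ∪ SB ∪ SC with hS
  have hSle : sampleLaw (jacobi β) m S ≤ ENNReal.ofReal ε := by
    have hC : sampleLaw (jacobi β) m SC ≤ ENNReal.ofReal (ε / 3) :=
      (measure_biUnion_finset_le _ _).trans hprob
    calc sampleLaw (jacobi β) m S
        ≤ sampleLaw (jacobi β) m S0 + sampleLaw (jacobi β) m SA + sampleLaw (jacobi β) m SB
          + sampleLaw (jacobi β) m SC :=
          (measure_union_le _ _).trans (add_le_add_left ((measure_union_le _ _).trans
            (add_le_add_left (measure_union_le _ _) _)) _)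
      _ ≤ 0 + ENNReal.ofReal (ε / 3) + ENNReal.ofReal (ε / 3) + ENNReal.ofReal (ε / 3) := by
          gcongr
          exact hS00.le
      _ = ENNReal.ofReal ε := by
          rw [zero_add, ← ENNReal.ofReal_add hε3.le hε3.le,
            ← ENNReal.ofReal_add (by positivity) hε3.le]
          congr 1
          ring
  -- f is only almost everywhere measurable, so the bad set need not be measurable; its measurable
  -- hull has the same measure.
  refine ⟨(toMeasurable (sampleLaw (jacobi β) m) S)ᶜ, (measurableSet_toMeasurable _ _).compl, ?_, ?_⟩
  · rw [prob_compl_eq_one_sub (measurableSet_toMeasurable _ _), measure_toMeasurable,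
      ENNReal.ofReal_sub _ hε.le, ENNReal.ofReal_one]
    exact tsub_le_tsub_left hSle 1
  intro x hx e
  have hxS : x ∉ S := fun h => hx (subset_toMeasurable _ _ h)
  simp only [hS, Set.mem_union, not_or] at hxS
  obtain ⟨⟨⟨hx0, hxA⟩, hxB⟩, hxC⟩ := hxS
  have hx0 : ∀ i, x i ∈ dom ∧ weight (jacobi β) (x i) = jacobiWeight β (x i) := by
    simpa only [hS0, Set.mem_ofPred_eq, not_not] using hx0
  have hw0 : ∀ i, 0 ≤ jacobiWeight β (x i) := fun i => (jacobiWeight_pos hβ (hx0 i).1).le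
  have hw : ∀ i, 0 ≤ weight (jacobi β) (x i) := fun i => by rw [(hx0 i).2]; exact hw0 i
  have hxA' : ∑ i, weight (jacobi β) (x i) * ‖f (x i) - g.eval (x i : ℂ)‖ ^ 2 ≤
      3 * m / ε * η ^ 2 := by
    simp only [hSA, Set.mem_ofPred_eq, not_lt] at hxA
    have h1 : ∑ i, φ (x i) = ENNReal.ofReal
        (∑ i, weight (jacobi β) (x i) * ‖f (x i) - g.eval (x i : ℂ)‖ ^ 2) := by
      rw [ENNReal.ofReal_sum_of_nonneg fun i _ => mul_nonneg (hw i) (sq_nonneg _)]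
      refine Finset.sum_congr rfl fun i _ => ?_
      rw [hφ, ENNReal.ofReal_mul (hw i), (hx0 i).2, ENNReal.ofReal_pow (norm_nonneg _),
        ofReal_norm]
    rw [h1, ← ENNReal.ofReal_natCast, ← ENNReal.ofReal_mul hm0.le,
      ← ENNReal.ofReal_mul (by positivity), ENNReal.ofReal_le_ofReal_iff (by positivity)] at hxA
    refine hxA.trans (le_of_eq ?_)
    field_simp
  have hxB' : ∀ i, weight (jacobi β) (x i) ≤ 3 * m / ε := by
    intro i
    simp only [hSB, Set.mem_ofPred_eq, not_lt] at hxB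
    rw [← ENNReal.ofReal_sum_of_nonneg fun i _ => hw0 i, mul_one, ← ENNReal.ofReal_natCast,
      ← ENNReal.ofReal_mul (by positivity), ENNReal.ofReal_le_ofReal_iff (by positivity)] at hxB
    rw [(hx0 i).2]
    refine (Finset.single_le_sum (f := fun i => jacobiWeight β (x i)) (fun i _ => hw0 i)
      (Finset.mem_univ i)).trans (hxB.trans (le_of_eq ?_))
    field_simp
  have hxC' : ∀ j < N, m * (a (j + 1) - a j) / 8 ≤
      ∑ i, (Set.Ico (a j) (a (j + 1))).indicator (fun _ => weight (jacobi β) (x i)) (x i) := by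
    intro j hj
    by_contra! hlt
    refine hxC ?_
    rw [hSC]
    refine Set.mem_biUnion (Finset.mem_coe.2 (Finset.mem_range.2 hj)) ?_
    simp only [Set.mem_ofPred_eq]
    refine le_trans (le_of_eq ?_) hlt.le
    refine Finset.sum_congr rfl fun i _ => ?_
    by_cases h : x i ∈ Set.Ico (a j) (a (j + 1))
    · rw [Set.indicator_of_mem h, Set.indicator_of_mem h, (hx0 i).2]
    · rw [Set.indicator_of_notMem h, Set.indicator_of_notMem h]
  obtain ⟨p, hp, hpu, hpg⟩ := exists_unique_estimator hn hw
    (fun q hq => polyNorm_sq_le_lsObjective hn hm hmono ha0 haN ha0' haN' hmesh hw hxC' hq)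
    (fun i => f (x i) + e i)
  refine ⟨p, hp, hpu, err_bounds hn hε hε1 hη0 hf hp.1 hg.1 hηe e ((hpg g hg.1).trans ?_)⟩
  exact mul_le_mul_of_nonneg_left (lsObjective_noisy_le hm hε hη0 hw hxA' hxB' e) (by norm_num)

theorem exists_quasiBest {β : ℝ} (hβ : -1 / 2 ≤ β) :
    ∃ M : ℝ, 0 < M ∧ ∀ n : ℕ, 1 ≤ n → ∀ ε : ℝ, 0 < ε → ε < 1 →
      ∃ m : ℕ, n ≤ m ∧ (m : ℝ) ≤ M * ((n : ℝ) ^ (2 * β + 2) * Real.log (3 * n / ε)) ∧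
        QuasiBest 20 (jacobi β) n m ε := by
  have hβ' : -1 < β := by linarith
  obtain ⟨c, hc, hcell⟩ := exists_cell_constant hβ
  -- The value 48/c makes the Chernoff exponent at least 6 log(3n/ε), and 1 ensures m ≥ n; doubling
  -- the constant pays for rounding up.
  set M0 : ℝ := max 1 (48 / c) with hM0
  have hM1 : 1 ≤ M0 := le_max_left _ _
  have hMc : 48 / c ≤ M0 := le_max_right _ _
  refine ⟨2 * M0, by positivity, ?_⟩
  intro n hn ε hε hε1
  have hn1 : (1 : ℝ) ≤ n := by exact_mod_cast hn
  set P : ℝ := (n : ℝ) ^ (2 * β + 2) with hP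
  have hPn : (n : ℝ) ≤ P := Real.self_le_rpow_of_one_le hn1 (by linarith)
  have hP0 : 0 < P := by linarith
  have hq3 : 3 ≤ 3 * n / ε := by
    rw [le_div_iff₀ hε]; nlinarith
  set Λ := Real.log (3 * n / ε) with hΛ
  have hΛ1 : 1 ≤ Λ := by
    rw [hΛ, Real.le_log_iff_exp_le (by linarith)]
    linarith [Real.exp_one_lt_d9]
  have hPL : P ≤ P * Λ := le_mul_of_one_le_right hP0.le hΛ1
  have hR : P * Λ ≤ M0 * (P * Λ) := le_mul_of_one_le_left (by positivity) hM1
  have hceil := Nat.le_ceil (M0 * (P * Λ))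
  set m := ⌈M0 * (P * Λ)⌉₊ with hm
  have hnm : n ≤ m := by
    have : (n : ℝ) ≤ m := by linarith
    exact_mod_cast this
  refine ⟨m, hnm, ?_, ?_⟩
  · have := Nat.ceil_lt_add_one (show 0 ≤ M0 * (P * Λ) by positivity)
    rw [← hm] at this
    linarith
  obtain ⟨a, ha0, haN, ha0', haN', hcells⟩ := exists_cosine_mesh hn
  refine quasiBest_of_cells hβ' hn (hn.trans hnm) hε hε1 (fun j hj => (hcells j hj).1) ha0 haN
    ha0' haN' (fun j hj => ?_) ?_
  · obtain ⟨-, s, -, -, h⟩ := hcells j hj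
    exact fun x hx => (h x hx).1
  have hone : ∀ j ∈ Finset.range (128 * n), sampleLaw (jacobi β) m
      {x | ∑ i, (Set.Ico (a j) (a (j + 1))).indicator (jacobiWeight β) (x i) ≤
        m * (a (j + 1) - a j) / 8} ≤ ENNReal.ofReal (ε / (384 * n)) := by
    intro j hj
    obtain ⟨hlt, s, hs, hsab, h⟩ := hcells j (Finset.mem_range.1 hj)
    obtain ⟨B, hB0, hB, hcB⟩ := hcell n hn _ _ s hs hsab fun x hx => (h x hx).2
    have hs0 : 0 < s := lt_of_lt_of_le (by positivity) hs
    have hdom : Set.Ico (a j) (a (j + 1)) ⊆ dom := fun x hx => by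
      have := (h x (Set.Ico_subset_Icc_self hx)).2.1
      have h1 : x ^ 2 < 1 := by nlinarith [sq_pos_of_pos hs0]
      exact abs_lt.1 ((sq_lt_one_iff_abs_lt_one x).1 h1)
    refine (sampleLaw_cell_le hβ' m hdom hB0 hB).trans (ENNReal.ofReal_le_ofReal ?_)
    set D := (a (j + 1) - a j) / B with hD
    have hD0 : 0 < D := div_pos (by linarith) hB0
    have hmD : 6 * Λ ≤ m * D / 8 := by
      have h1 : 48 * Λ ≤ (M0 * (P * Λ)) * D := by
        rw [div_le_iff₀ hc] at hMc
        have h2 : M0 * c ≤ M0 * (D * P) := mul_le_mul_of_nonneg_left hcB (by positivity)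
        calc 48 * Λ ≤ M0 * (D * P) * Λ := mul_le_mul_of_nonneg_right (hMc.trans h2) (by positivity)
          _ = _ := by ring
      have h3 := h1.trans (mul_le_mul_of_nonneg_right hceil hD0.le)
      linarith
    -- Over 128n cells this totals ε/3. With y = 3n/ε ≥ 3 the claim is 128y ≤ y⁶, true since 3⁵ =
    -- 243.
    have h6 : Real.exp (-(6 * Λ)) ≤ ε / (384 * n) := by
      have e : Real.exp (-(6 * Λ)) = ((3 * n / ε) ^ 6)⁻¹ := by
        rw [Real.exp_neg, hΛ]
        congr 1
        rw [show (6 : ℝ) = ((6 : ℕ) : ℝ) by norm_num, Real.exp_nat_mul,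
          Real.exp_log (by positivity)]
      have e' : ε / (384 * n) = (128 * (3 * n / ε))⁻¹ := by
        field_simp
        norm_num
      rw [e, e']
      refine inv_anti₀ (by positivity) ?_
      have h5 : (3 : ℝ) ^ 5 ≤ (3 * n / ε) ^ 5 := pow_le_pow_left₀ (by norm_num) hq3 5
      calc 128 * (3 * n / ε) ≤ (3 * n / ε) ^ 5 * (3 * n / ε) :=
            mul_le_mul_of_nonneg_right (by linarith) (by positivity)
        _ = _ := by ring
    exact (Real.exp_le_exp.2 (neg_le_neg hmD)).trans h6
  refine (Finset.sum_le_sum hone).trans ?_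
  rw [Finset.sum_const, Finset.card_range, nsmul_eq_mul, ← ENNReal.ofReal_natCast,
    ← ENNReal.ofReal_mul (by positivity)]
  refine ENNReal.ofReal_le_ofReal (le_of_eq ?_)
  push_cast
  field_simp
  norm_num

theorem exists_cost_and_quasiBest {α β : ℝ} (hβ : -1 / 2 ≤ β) (hαβ : -1 < β - α) :
    ∃ K : ℝ, 0 < K ∧ ∀ n : ℕ, 1 ≤ n → ∀ ε : ℝ, 0 < ε → ε < 1 →
      ∃ m : ℕ, n ≤ m ∧
        (∀ (A : ℝ) (c : ℝ → ℝ), IsCost α A c → expectedCost (jacobi β) m c ≤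
          ENNReal.ofReal (K * A * ((n : ℝ) ^ (2 * β + 2) * Real.log (3 * n / ε)))) ∧
        QuasiBest 20 (jacobi β) n m ε := by
  have hβ' : -1 < β := by linarith
  obtain ⟨M, hM, h⟩ := exists_quasiBest hβ
  have hr : 0 < jacobiMass (β - α) / jacobiMass β :=
    div_pos (jacobiMass_pos hαβ) (jacobiMass_pos hβ')
  refine ⟨M * (jacobiMass (β - α) / jacobiMass β), by positivity, ?_⟩
  intro n hn ε hε hε1
  obtain ⟨m, hnm, hm, hq⟩ := h n hn ε hε hε1
  refine ⟨m, hnm, fun A c hc => (expectedCost_jacobi_le hβ' hαβ m hc).trans ?_, hq⟩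
  have hA : 0 < A := by
    have := hc.2 0 (by simp [dom])
    norm_num at this
    linarith
  refine ENNReal.ofReal_le_ofReal ?_
  calc _ ≤ M * ((n : ℝ) ^ (2 * β + 2) * Real.log (3 * n / ε)) *
        (A * (jacobiMass (β - α) / jacobiMass β)) :=
        mul_le_mul_of_nonneg_right hm (by positivity)
    _ = _ := by ring

end WLSCost

theorem mainTheorem4 :
    ∃ C : ℝ, 0 < C ∧
      (∀ α : ℝ, 0 ≤ α → α < 1 / 2 →
        ∃ K : ℝ, 0 < K ∧ ∀ n : ℕ, 1 ≤ n → ∀ ε : ℝ, 0 < ε → ε < 1 →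
          ∃ m : ℕ, n ≤ m ∧
            (∀ (A : ℝ) (c : ℝ → ℝ), WLSCost.IsCost α A c →
              WLSCost.expectedCost (WLSCost.jacobi (-1 / 2)) m c ≤
                ENNReal.ofReal (K * A * ((n : ℝ) * Real.log (3 * n / ε)))) ∧
            WLSCost.QuasiBest C (WLSCost.jacobi (-1 / 2)) n m ε) ∧
      (∀ α : ℝ, 1 / 2 ≤ α → ∀ δ : ℝ, 0 < δ →
        ∃ K : ℝ, 0 < K ∧ ∀ n : ℕ, 1 ≤ n → ∀ ε : ℝ, 0 < ε → ε < 1 →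
          ∃ m : ℕ, n ≤ m ∧
            (∀ (A : ℝ) (c : ℝ → ℝ), WLSCost.IsCost α A c →
              WLSCost.expectedCost (WLSCost.jacobi (α - 1 + δ)) m c ≤
                ENNReal.ofReal
                  (K * A * ((n : ℝ) ^ (2 * (α + δ)) * Real.log (3 * n / ε)))) ∧
            WLSCost.QuasiBest C (WLSCost.jacobi (α - 1 + δ)) n m ε) := by
  refine ⟨20, by norm_num, fun α _ hα => ?_, fun α hα δ hδ => ?_⟩
  · have h := WLSCost.exists_cost_and_quasiBest (α := α) (β := -1 / 2) le_rfl (by linarith)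
    rw [show 2 * (-1 / 2 : ℝ) + 2 = 1 by norm_num] at h
    simpa only [Real.rpow_one] using h
  · have h := WLSCost.exists_cost_and_quasiBest (α := α) (β := α - 1 + δ) (by linarith)
      (by linarith)
    rwa [show 2 * (α - 1 + δ) + 2 = 2 * (α + δ) by ring] at h
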